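/- Let $k\ge 2$ and $3\le r<2k$ be integers, and put $d=2k+r$, $\alpha_1=1-\frac{r}{2k}$, $\alpha_2=\frac{r}{2k}$. Let $h(x)=-x\log x$ for $x\in(0,1]$, $h(0)=0$, and $H(x)=h(x)+h(1-x)$. For $x,t\in[0,1]$ with $(2-t)x\le 1$ define $$F(x,t)=\tfrac12 h(tx)+h\big((1-t)x\big)+\tfrac12 h\big(1-(2-t)x\big)-H(x),\qquad F_d(x,t)=d\,F(x,t)+H(x),$$ and for $0\le x\le\alpha\le 1$ let $g(\alpha,x)=h(x)+h(\alpha-x)-h(\alpha)$. For $x_1\in[0,\alpha_1]$, $x_2\in[0,\alpha_2]$ with $x_1+x_2>0$ and $x_1\alpha_2\le\alpha_1x_2$ let $$\eta(x_1,x_2)=d\,F\!\left(x_1+x_2,\ \frac{2r}{d}+\frac{2kx_1}{d(x_1+x_2)}\right)+g(\alpha_1,x_1)+g(\alpha_2,x_2).$$ Then there exist $0<x_-<x_+<1$ with $x_-<\frac{2r}{d}$ and $1-x_+<\frac{2k}{d}$ such that $$F_d\!\left(x_-,\tfrac{2r}{d}\right)<0,\qquad F_d\!\left(1-x_+,\tfrac{2k}{d}\right)<0,$$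 and $\eta(x_1,x_2)<0$ for all $x_1\in[0,\alpha_1]$, $x_2\in[0,\alpha_2]$ with $x_1+x_2\in[x_-,x_+]$ and $x_1\alpha_2\le\alpha_1x_2$ (that is, $x_1/x_2\le\alpha_1/\alpha_2$). -/

import Mathlib

namespace StarProfile

/-- `F(x,t) = ½ h(tx) + h((1-t)x) + ½ h(1-(2-t)x) - H(x)`, where `h(x) = -x log x` (`h(0) = 0`) is
`Real.negMulLog` and `H(x) = h(x) + h(1-x)`.
Meaningful for `x, t ∈ [0,1]` with `(2-t)x ≤ 1`. -/
noncomputable def F (x t : ℝ) : ℝ :=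
  (1 / 2) * Real.negMulLog (t * x) + Real.negMulLog ((1 - t) * x)
    + (1 / 2) * Real.negMulLog (1 - (2 - t) * x)
    - (Real.negMulLog x + Real.negMulLog (1 - x))

/-- `F_d(x,t) = d F(x,t) + H(x)`. -/
noncomputable def Fd (d x t : ℝ) : ℝ :=
  d * F x t + (Real.negMulLog x + Real.negMulLog (1 - x))

/-- `g(α,x) = h(x) + h(α-x) - h(α)`, the exponential rate of the number of subsets of size `xN`
of a set of size `αN`; meaningful for `0 ≤ x ≤ α ≤ 1`. -/
noncomputable def g (α x : ℝ) : ℝ :=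
  Real.negMulLog x + Real.negMulLog (α - x) - Real.negMulLog α

/-- The degree `d = 2k + r`. -/
def deg (k r : ℕ) : ℝ := 2 * (k : ℝ) + (r : ℝ)

/-- `α₁ = 1 - r/(2k)`. -/
noncomputable def α₁ (k r : ℕ) : ℝ := 1 - (r : ℝ) / (2 * (k : ℝ))

/-- `α₂ = r/(2k)`. -/
noncomputable def α₂ (k r : ℕ) : ℝ := (r : ℝ) / (2 * (k : ℝ))

/-- The exponent `η(x₁,x₂)`, with
`t = 2r/d + 2k x₁ / (d (x₁+x₂))` as the second argument of `F`. -/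
noncomputable def η (k r : ℕ) (x₁ x₂ : ℝ) : ℝ :=
  deg k r * F (x₁ + x₂)
      (2 * (r : ℝ) / deg k r + 2 * (k : ℝ) * x₁ / (deg k r * (x₁ + x₂)))
    + g (α₁ k r) x₁ + g (α₂ k r) x₂

end StarProfile

/-! Write `ρ = α₂ k r`. The value `F x t` is `-1/2` times the relative entropy of the edge
distribution `(tx, 2(1-t)x, 1-(2-t)x)` with respect to the product law of density `x`. `F_le_neg_Ψ`
makes this quantitative as `F ≤ -(tx/2) Ψ`.

Fix `x = x₁ + x₂`. For `x ≤ ρ` compare with the split `x₁ = 0`, where `t = 2r/d`. For `x ≥ ρ`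
complement all densities, which swaps the two pure edge classes, and compare with `x₂ = α₂`, where
`t = 2k/d`. In `exponent_le` the entropies that depend on the split are bounded by tangent lines
whose contact points make the dependence on the split cancel, leaving `d F + x (pen - log s)`, where
`s` is `x` (or `1 - x`) relative to the size of the dominant part. Since `d t = 2κ` with `κ = r` or
`κ = k`, it remains to show `pen μ ε s - log s < κ Ψ` for some `μ > 0`; this is
`exists_pen_lt_lower` and `exists_pen_lt_upper`. The delicate regime is small `ρ` with `x` just
above `ρ`: there `μ` must scale like `ρ`.

So `η < 0` whenever `0 < x < 1`, and `x₋`, `x₊` need only meet the first-moment conditions, which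
`Fd_neg` provides. -/

namespace StarProfile

open Real

/-! ### Elementary bounds on logarithms -/

/-- Tangent line bound for the entropy function. -/
theorem negMulLog_le_tangent {a q : ℝ} (ha : 0 ≤ a) (hq : 0 < q) :
    negMulLog a ≤ -(a * log q) + q - a := by
  rcases ha.eq_or_lt with rfl | ha
  · simp [hq.le]
  · have h := log_le_sub_one_of_pos (div_pos hq ha)
    rw [log_div hq.ne' ha.ne'] at h
    have h2 := mul_le_mul_of_nonneg_left h ha.le
    have h3 : a * (q / a - 1) = q - a := by field_simp
    unfold negMulLog
    nlinarith

theorem two_mul_div_le_neg_log {s : ℝ} (hs : 0 < s) (hs1 : s ≤ 1) :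
    2 * (1 - s) / (1 + s) ≤ -log s := by
  have h := le_log_one_add_of_nonneg (x := 1 / s - 1) (by
    rw [sub_nonneg, le_div_iff₀ hs]; linarith)
  have e : 1 + (1 / s - 1) = s⁻¹ := by ring
  rw [e, log_inv] at h
  have e2 : 1 / s - 1 + 2 = (1 + s) / s := by field_simp; ring
  have e3 : 2 * (1 / s - 1) = 2 * (1 - s) / s := by field_simp
  rwa [e2, e3, div_div_div_cancel_right₀ hs.ne'] at h

/-- `t log t` dominates its second order expansion at `1`, to the left of `1`. -/
theorem quadratic_le_mul_log {t : ℝ} (ht : 0 < t) (ht1 : t ≤ 1) :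
    t - 1 + (t - 1) ^ 2 / 2 ≤ t * log t := by
  -- With `x = 1/t` the claim is `log x ≤ (x - 1/x)/2`, and the difference has derivative
  -- `(x-1)²/(2x²)`.
  have key : ∀ x ∈ Set.Ici (1 : ℝ), 0 ≤ (x - x⁻¹) / 2 - log x := by
    have hm : MonotoneOn (fun x : ℝ => (x - x⁻¹) / 2 - log x) (Set.Ici 1) := by
      apply monotoneOn_of_deriv_nonneg (convex_Ici 1)
      · apply ContinuousOn.sub
        · apply ContinuousOn.div_const
          exact continuousOn_id.sub (continuousOn_id.inv₀ fun x hx => by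
            have : (1 : ℝ) ≤ x := hx
            simp; linarith)
        · exact continuousOn_id.log fun x hx => by
            have : (1 : ℝ) ≤ x := hx
            simp; linarith
      · intro x hx
        rw [interior_Ici] at hx
        have : x ≠ 0 := by have : (1 : ℝ) < x := hx; linarith
        exact ((((hasDerivAt_id x).sub (hasDerivAt_inv this)).div_const 2).sub
          (hasDerivAt_log this)).differentiableAt.differentiableWithinAt
      · intro x hx
        rw [interior_Ici] at hx
        have h1 : (1 : ℝ) < x := hx
        have h0 : x ≠ 0 := by linarith
        have hd := ((((hasDerivAt_id x).sub (hasDerivAt_inv h0)).div_const 2).sub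
          (hasDerivAt_log h0)).deriv
        have : deriv (fun x : ℝ => (x - x⁻¹) / 2 - log x) x = (1 - -(x ^ 2)⁻¹) / 2 - x⁻¹ := hd
        rw [this]
        have e : (1 - -(x ^ 2)⁻¹) / 2 - x⁻¹ = (x - 1) ^ 2 / (2 * x ^ 2) := by
          field_simp; ring
        rw [e]; positivity
    intro x hx
    have := hm (Set.mem_Ici.2 le_rfl) hx hx
    simpa using this
  have h := key t⁻¹ (by rw [Set.mem_Ici]; exact (one_le_inv₀ ht).2 ht1)
  rw [inv_inv, log_inv] at h
  have h2 := mul_nonneg ht.le h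
  have e : t * ((t⁻¹ - t) / 2 - -log t) = (1 - t ^ 2) / 2 + t * log t := by
    field_simp
    ring
  rw [e] at h2
  nlinarith

/-- A rational lower bound for `t log t` to the right of `1`. -/
theorem rational_le_mul_log {t : ℝ} (ht : 1 ≤ t) :
    t - 1 + 3 * (t - 1) ^ 2 / (2 * (t + 2)) ≤ t * log t := by
  -- The bound divided by `t`; it agrees with `log` to third order at `1`, so the derivative of the
  -- difference carries the factor `(x-1)³`.
  have key : ∀ x ∈ Set.Ici (1 : ℝ), 0 ≤ log x - (x - 1) * (5 * x + 1) / (2 * x * (x + 2)) := by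
    have hder : ∀ x : ℝ, 0 < x → HasDerivAt
        (fun x : ℝ => log x - (x - 1) * (5 * x + 1) / (2 * x * (x + 2)))
        ((x - 1) ^ 3 / (x ^ 2 * (x + 2) ^ 2)) x := by
      intro x hx
      have h1 : HasDerivAt (fun x : ℝ => (x - 1) * (5 * x + 1))
          (1 * (5 * x + 1) + (x - 1) * (5 * 1)) x :=
        ((hasDerivAt_id x).sub_const 1).mul (((hasDerivAt_id x).const_mul 5).add_const 1)
      have h2 : HasDerivAt (fun x : ℝ => 2 * x * (x + 2))
          (2 * 1 * (x + 2) + 2 * x * 1) x :=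
        ((hasDerivAt_id x).const_mul 2).mul ((hasDerivAt_id x).add_const 2)
      have h3 := (hasDerivAt_log hx.ne').sub (h1.div h2 (by positivity))
      refine h3.congr_deriv ?_
      field_simp
      ring
    have hm : MonotoneOn
        (fun x : ℝ => log x - (x - 1) * (5 * x + 1) / (2 * x * (x + 2))) (Set.Ici 1) := by
      apply monotoneOn_of_deriv_nonneg (convex_Ici 1)
      · intro x hx
        have : (1 : ℝ) ≤ x := hx
        exact (hder x (by linarith)).continuousAt.continuousWithinAt
      · intro x hx
        rw [interior_Ici] at hx
        have : (1 : ℝ) < x := hx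
        exact (hder x (by linarith)).differentiableAt.differentiableWithinAt
      · intro x hx
        rw [interior_Ici] at hx
        have h1 : (1 : ℝ) < x := hx
        rw [(hder x (by linarith)).deriv]
        have : 0 ≤ x - 1 := by linarith
        positivity
    intro x hx
    have := hm (Set.mem_Ici.2 le_rfl) hx hx
    simpa using this
  have h := key t ht
  have h2 := mul_nonneg (by linarith : 0 ≤ t) h
  have h0 : 0 < t := by linarith
  have e : t * (log t - (t - 1) * (5 * t + 1) / (2 * t * (t + 2)))
      = t * log t - (t - 1 + 3 * (t - 1) ^ 2 / (2 * (t + 2))) := by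
    field_simp
    ring
  rw [e] at h2
  linarith

theorem mul_log_div_ge_of_le {b b₀ : ℝ} (hb : 0 < b) (hbb : b ≤ b₀) :
    b - b₀ + (b₀ - b) ^ 2 / (2 * b₀) ≤ b * log (b / b₀) := by
  have h0 : 0 < b₀ := by linarith
  have h := mul_le_mul_of_nonneg_left
    (quadratic_le_mul_log (div_pos hb h0) ((div_le_one h0).2 hbb)) h0.le
  have e1 : b₀ * (b / b₀ * log (b / b₀)) = b * log (b / b₀) := by field_simp
  have e2 : b₀ * (b / b₀ - 1 + (b / b₀ - 1) ^ 2 / 2) = b - b₀ + (b₀ - b) ^ 2 / (2 * b₀) := by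
    field_simp; ring
  rwa [e1, e2] at h

theorem mul_log_div_ge_of_ge {c c₀ : ℝ} (hc : 0 < c₀) (hcc : c₀ ≤ c) :
    c - c₀ + 3 * (c - c₀) ^ 2 / (2 * (c + 2 * c₀)) ≤ c * log (c / c₀) := by
  have h := mul_le_mul_of_nonneg_left
    (rational_le_mul_log ((one_le_div hc).2 hcc)) hc.le
  have h0 : 0 < c := by linarith
  have e1 : c₀ * (c / c₀ * log (c / c₀)) = c * log (c / c₀) := by field_simp
  have e2 : c₀ * (c / c₀ - 1 + 3 * (c / c₀ - 1) ^ 2 / (2 * (c / c₀ + 2)))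
      = c - c₀ + 3 * (c - c₀) ^ 2 / (2 * (c + 2 * c₀)) := by
    field_simp
  rwa [e1, e2] at h

/-! ### Relative entropy bound for `F` -/

/-- The lower bound for the rate `-2 F(x,t) / (t x)` used below. -/
noncomputable def Ψ (x t : ℝ) : ℝ :=
  log (t / x) - 1 + x / t + (t - x) ^ 2 / (t * (1 - x))
    + 3 / 2 * (x * (t - x) ^ 2) / (t * (3 * (1 - x) ^ 2 + x * (t - x)))

/-- For `x ≤ t` the mixed class `(1-t)x` lies below its product value `x(1-x)` and the class
`1-(2-t)x` above `(1-x)²`, so each gets the bound valid on its side of `1`. The class `tx` keeps its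
exact logarithm. -/
theorem F_le_neg_Ψ {x t : ℝ} (hx : 0 < x) (hx1 : x < 1) (hxt : x ≤ t) (ht : t < 1)
    (hC : 0 < 1 - (2 - t) * x) : F x t ≤ -(t * x / 2 * Ψ x t) := by
  have ht0 : 0 < t := by linarith
  have hy : 0 < 1 - x := by linarith
  have hB : 0 < (1 - t) * x := mul_pos (by linarith) hx
  have h1 := mul_log_div_ge_of_le hB (b₀ := x * (1 - x)) (by nlinarith)
  have h2 := mul_log_div_ge_of_ge (c := 1 - (2 - t) * x) (c₀ := (1 - x) ^ 2) (by positivity)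
    (by nlinarith)
  rw [log_div hB.ne' (by positivity), log_mul hx.ne' hy.ne'] at h1
  rw [log_div hC.ne' (by positivity), log_pow] at h2
  have e1 : (x * (1 - x) - (1 - t) * x) ^ 2 / (2 * (x * (1 - x)))
      = x * (t - x) ^ 2 / (2 * (1 - x)) := by
    field_simp; ring
  have hq : 0 ≤ x * (t - x) := mul_nonneg hx.le (by linarith)
  have hden : 0 < 3 * (1 - x) ^ 2 + x * (t - x) := by positivity
  have hden' : 1 - (2 - t) * x + 2 * (1 - x) ^ 2 = 3 * (1 - x) ^ 2 + x * (t - x) := by ring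
  have e2 : 3 * (1 - (2 - t) * x - (1 - x) ^ 2) ^ 2 / (2 * (1 - (2 - t) * x + 2 * (1 - x) ^ 2))
      = 3 / 2 * (x * (t - x)) ^ 2 / (3 * (1 - x) ^ 2 + x * (t - x)) := by
    rw [hden']; field_simp; ring
  rw [e1] at h1
  rw [e2] at h2
  have e3 : t * x * Ψ x t = t * x * (log t - log x) - t * x + x ^ 2
      + x * (t - x) ^ 2 / (1 - x)
      + 3 / 2 * (x * (t - x)) ^ 2 / (3 * (1 - x) ^ 2 + x * (t - x)) := by
    unfold Ψ
    rw [log_div ht0.ne' hx.ne']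
    field_simp
  have e4 : x * (t - x) ^ 2 / (2 * (1 - x)) = x * (t - x) ^ 2 / (1 - x) / 2 := by
    field_simp
  rw [e4] at h1
  have e5 : F x t = -(t * x * (log t + log x)) / 2 - (1 - t) * x * log ((1 - t) * x)
      - (1 - (2 - t) * x) * log (1 - (2 - t) * x) / 2 + x * log x + (1 - x) * log (1 - x) := by
    unfold F negMulLog
    rw [log_mul ht0.ne' hx.ne']
    ring
  rw [e5]
  push_cast at h2
  nlinarith

/-! ### Eliminating the split -/

/-- The penalty that remains after eliminating the split of `x` between the two parts. -/
noncomputable def pen (μ ε s : ℝ) : ℝ :=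
  μ + (1 - s) / s * -log (1 - s + μ * s) + ε * s ^ 2 / (1 - s + μ * s)

/-- Gibbs' inequality on the edge distribution, compared with the one at `t`. -/
theorem edge_entropy_le {x t Δ : ℝ} (hx : 0 < x) (ht0 : 0 < t) (ht1 : t < 1)
    (hC : 0 < 1 - (2 - t) * x) (hΔ : 0 ≤ Δ) (hB : 0 ≤ (1 - t) * x - Δ) :
    1 / 2 * negMulLog (t * x + Δ) + negMulLog ((1 - t) * x - Δ)
      + 1 / 2 * negMulLog (1 - (2 - t) * x + Δ) - (negMulLog x + negMulLog (1 - x))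
    ≤ F x t - Δ / 2 * log (t * (1 - (2 - t) * x) / ((1 - t) ^ 2 * x)) := by
  have hA0 : 0 < t * x := mul_pos ht0 hx
  have hB0 : 0 < (1 - t) * x := mul_pos (by linarith) hx
  have a1 := negMulLog_le_tangent (a := t * x + Δ) (by positivity) hA0
  have a2 := negMulLog_le_tangent hB hB0
  have a3 := negMulLog_le_tangent (a := 1 - (2 - t) * x + Δ) (by positivity) hC
  have e : t * (1 - (2 - t) * x) / ((1 - t) ^ 2 * x)
      = t * x * (1 - (2 - t) * x) / ((1 - t) * x) ^ 2 := by
    field_simp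
  rw [e, log_div (by positivity) (by positivity), log_mul hA0.ne' hC.ne', log_pow]
  unfold F
  rw [negMulLog_def] at *
  simp only at *
  push_cast
  nlinarith

theorem g_le_tangent {α x q : ℝ} (hα : 0 < α) (hx : 0 ≤ x) (hxα : x ≤ α) (hq : 0 < q)
    (hq1 : q < 1) : g α x ≤ -(x * log q) - (α - x) * log (1 - q) := by
  have h1 := negMulLog_le_tangent hx (mul_pos hα hq)
  have h2 := negMulLog_le_tangent (a := α - x) (by linarith)
    (mul_pos hα (by linarith : 0 < 1 - q))
  rw [log_mul hα.ne' hq.ne'] at h1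
  rw [log_mul hα.ne' (by linarith : (1 - q) ≠ 0)] at h2
  unfold g
  have e : negMulLog α = -(α * log α) := by simp [negMulLog]
  rw [e]
  nlinarith

/-- Upper bound for the exponent in terms of `F` at the extreme value of its second argument. -/
theorem exponent_le {k : ℕ} {d x t α β ξ ζ Δ μ c : ℝ} (hk : 2 ≤ k)
    (hα : 0 < α) (hβ : 0 < β) (hξ : 0 ≤ ξ) (hξα : ξ ≤ α) (hζ : 0 ≤ ζ) (hζβ : ζ ≤ β)
    (hxe : x = ξ + ζ) (hx : 0 < x) (hxα : x ≤ α) (ht0 : 0 < t) (ht1 : t < 1)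
    (hC : 0 < 1 - (2 - t) * x) (hΔ : 0 ≤ Δ) (hB : 0 ≤ (1 - t) * x - Δ)
    (hd : 0 ≤ d) (hdΔ : d * Δ = 2 * k * ζ) (hμ : 0 < μ) (hc : 0 < c)
    (hΛ : 1 / (c * (x / α)) ≤ t * (1 - (2 - t) * x) / ((1 - t) ^ 2 * x)) :
    d * (1 / 2 * negMulLog (t * x + Δ) + negMulLog ((1 - t) * x - Δ)
      + 1 / 2 * negMulLog (1 - (2 - t) * x + Δ) - (negMulLog x + negMulLog (1 - x)))
      + g α ξ + g β ζ
    ≤ d * F x t + x * (pen μ (β / α * c ^ k) (x / α) - log (x / α)) := by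
  have h1 := mul_le_mul_of_nonneg_left (edge_entropy_le hx ht0 ht1 hC hΔ hB) hd
  set Λ := t * (1 - (2 - t) * x) / ((1 - t) ^ 2 * x) with hΛdef
  set s := x / α with hs
  have hs0 : 0 < s := div_pos hx hα
  have hs1 : s ≤ 1 := (div_le_one hα).2 hxα
  have hxs : x = α * s := by rw [hs]; field_simp
  have hΛ0 : 0 < Λ := lt_of_lt_of_le (by positivity) hΛ
  set D := 1 - s + μ * s with hD
  have hD0 : 0 < D := by
    have := mul_pos hμ hs0
    linarith
  have hμs : 0 < 1 + μ * s := by positivity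
  -- the point of tangency for the main part has odds `s / D`
  have hw := g_le_tangent (q := s / (1 + μ * s)) hα hξ hξα (by positivity)
    ((div_lt_one hμs).2 (by linarith))
  have hw1 : 1 - s / (1 + μ * s) = D / (1 + μ * s) := by
    rw [hD]; field_simp; ring
  rw [hw1, log_div hs0.ne' hμs.ne', log_div hD0.ne' hμs.ne'] at hw
  -- the point of tangency for the other part has odds `o`
  set o := s / D / Λ ^ k with ho
  have ho0 : 0 < o := by positivity
  have hq := g_le_tangent (q := o / (1 + o)) hβ hζ hζβ (by positivity)
    ((div_lt_one (by linarith)).2 (by linarith))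
  have hq1 : 1 - o / (1 + o) = 1 / (1 + o) := by field_simp; ring
  rw [hq1, log_div ho0.ne' (by positivity), log_div one_ne_zero (by positivity), log_one] at hq
  have hlo : log o = log s - log D - k * log Λ := by
    rw [ho, log_div (by positivity) (by positivity), log_div hs0.ne' hD0.ne', log_pow]
  have hlog1 : log (1 + o) ≤ o := by
    have := log_le_sub_one_of_pos (by positivity : 0 < 1 + o)
    linarith
  have hlog2 : log (1 + μ * s) ≤ μ * s := by
    have := log_le_sub_one_of_pos hμs
    linarith
  have hoε : o ≤ c ^ k * s ^ 2 * s / D := by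
    have hp : (1 / (c * s)) ^ k ≤ Λ ^ k := pow_le_pow_left₀ (by positivity) hΛ k
    -- Only `k ≥ 2` and `s ≤ 1` are used here; this is the origin of `s ^ 2` in `pen`.
    have hcs : (c * s) ^ k ≤ c ^ k * s ^ 2 := by
      rw [mul_pow]
      exact mul_le_mul_of_nonneg_left (pow_le_pow_of_le_one hs0.le hs1 hk) (by positivity)
    calc o = s / D * (1 / Λ ^ k) := by rw [ho]; ring
      _ ≤ s / D * (c * s) ^ k := by
          apply mul_le_mul_of_nonneg_left _ (by positivity)
          rw [one_div_pow] at hp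
          rw [div_le_iff₀ (by positivity)]
          rwa [div_le_iff₀ (by positivity), mul_comm] at hp
      _ ≤ s / D * (c ^ k * s ^ 2) := mul_le_mul_of_nonneg_left hcs (by positivity)
      _ = c ^ k * s ^ 2 * s / D := by ring
  have hpen : x * (pen μ (β / α * c ^ k) s - log s)
      = α * (μ * s) - α * (1 - s) * log D + β * (c ^ k * s ^ 2 * s / D) - α * s * log s := by
    unfold pen
    rw [← hD, hxs]
    field_simp
    ring
  rw [hpen]
  have e1 : d * (F x t - Δ / 2 * log Λ) = d * F x t - k * ζ * log Λ := by
    rw [mul_sub, show d * (Δ / 2 * log Λ) = d * Δ / 2 * log Λ by ring, hdΔ]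
    ring
  rw [e1] at h1
  have hβo : β * log (1 + o) ≤ β * (c ^ k * s ^ 2 * s / D) :=
    mul_le_mul_of_nonneg_left (hlog1.trans hoε) hβ.le
  have hαμ : α * log (1 + μ * s) ≤ α * (μ * s) := mul_le_mul_of_nonneg_left hlog2 hα.le
  have hξe : ξ = α * s - ζ := by rw [← hxs, hxe]; ring
  rw [hlo] at hq
  -- The two odds differ by the factor `Λ ^ k`, so `ζ` survives only through `k ζ log Λ`, which the
  -- edge term cancels.
  have hsum : -(ξ * (log s - log (1 + μ * s))) - (α - ξ) * (log D - log (1 + μ * s))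
      + (-(ζ * (log s - log D - k * log Λ - log (1 + o))) - (β - ζ) * (0 - log (1 + o)))
      = α * log (1 + μ * s) - α * (1 - s) * log D - α * s * log s + k * ζ * log Λ
        + β * log (1 + o) := by
    rw [hξe]; ring
  linarith

/-! ### One-variable bounds for `pen` -/

/-- Tangent line to `log` at `1` in the variable `1/(4D)`, `D = 1-s+μs`; the constant is `2 log 2 -
1 < 0.3863`. -/
theorem pen_le_of_half_le {μ ε ε' s : ℝ} (hμ : 0 < μ) (hε : ε ≤ ε') (hs : 0 < s) (hs1 : s ≤ 1) :
    pen μ ε s ≤ μ + (1 - s) / s * (0.3863 + 1 / (4 * (1 - s + μ * s)))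
      + ε' * s ^ 2 / (1 - s + μ * s) := by
  have hD : 0 < 1 - s + μ * s := by have := mul_pos hμ hs; linarith
  have h := log_le_sub_one_of_pos (show 0 < 1 / (4 * (1 - s + μ * s)) by positivity)
  rw [log_div one_ne_zero (by positivity), log_one, log_mul (by norm_num) hD.ne',
    show (4 : ℝ) = 2 ^ 2 by norm_num, log_pow] at h
  have h2 := log_two_lt_d9
  push_cast at h
  have h3 : -log (1 - s + μ * s) ≤ 0.3863 + 1 / (4 * (1 - s + μ * s)) := by
    norm_num at h ⊢
    linarith
  unfold pen
  have h4 : 0 ≤ (1 - s) / s := div_nonneg (by linarith) hs.le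
  gcongr

/-- By `-log D ≤ 1/D - 1` the middle term is at most `(1-μ)(1-s)/D ≤ 1-μ`, which absorbs the summand
`μ`. -/
theorem pen_le_of_le_half {μ ε ε' s : ℝ} (hμ : 0 < μ) (hμ1 : μ ≤ 1) (hε0 : 0 ≤ ε')
    (hε : ε ≤ ε') (hs : 0 < s) (hs1 : s ≤ 1 / 2) :
    pen μ ε s ≤ 1 + ε' / 2 := by
  have hμs := mul_pos hμ hs
  have hD : 0 < 1 - s + μ * s := by linarith
  have h := one_sub_inv_le_log_of_pos hD
  have h4 : 0 ≤ (1 - s) / s := div_nonneg (by linarith) hs.le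
  have h5 : (1 - s) / s * -log (1 - s + μ * s) ≤ (1 - s) / s * ((1 - s + μ * s)⁻¹ - 1) :=
    mul_le_mul_of_nonneg_left (by linarith) h4
  have h6 : (1 - s) / s * ((1 - s + μ * s)⁻¹ - 1) = (1 - μ) * ((1 - s) / (1 - s + μ * s)) := by
    generalize hDe : 1 - s + μ * s = D at hD ⊢
    have : μ = (D - 1 + s) / s := by rw [← hDe]; field_simp; ring
    rw [this]
    field_simp
    ring
  have h7 : (1 - s) / (1 - s + μ * s) ≤ 1 := by
    rw [div_le_one hD]; linarith
  have h8 : ε * s ^ 2 / (1 - s + μ * s) ≤ ε' / 2 := by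
    rw [div_le_iff₀ hD]
    have hs2 : s ^ 2 ≤ 1 / 4 := by nlinarith
    have : ε * s ^ 2 ≤ ε' * s ^ 2 := mul_le_mul_of_nonneg_right hε (by positivity)
    nlinarith
  unfold pen
  nlinarith

theorem pen_lt_of_polynomial {μ ε ε' s c₀ c₁ c₂ : ℝ} (hμ : 0 < μ) (hε : ε ≤ ε') (hs : 0 < s)
    (hs1 : s ≤ 1) (hc : 0 ≤ c₂)
    (h : (1 - s) * (1 + s) * (0.3863 * (1 - s + μ * s) + 1 / 4) + ε' * s ^ 3 * (1 + s)
      + μ * (s * (1 + s) * (1 - s + μ * s))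
      < (c₀ + c₁ * s) * (s * (1 + s) * (1 - s + μ * s))
        + c₂ * (2 * (1 - s) * s * (1 - s + μ * s))) :
    pen μ ε s < c₀ + c₁ * s - c₂ * log s := by
  have h1 := pen_le_of_half_le hμ hε hs hs1
  have hL := mul_le_mul_of_nonneg_left (two_mul_div_le_neg_log hs hs1) hc
  have hD : 0 < 1 - s + μ * s := by have := mul_pos hμ hs; linarith
  generalize 1 - s + μ * s = D at h h1 hD
  suffices h2 : μ + (1 - s) / s * (0.3863 + 1 / (4 * D)) + ε' * s ^ 2 / D <
      c₀ + c₁ * s + c₂ * (2 * (1 - s) / (1 + s)) by linarith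
  have e1 : μ + (1 - s) / s * (0.3863 + 1 / (4 * D)) + ε' * s ^ 2 / D
      = ((1 - s) * (1 + s) * (0.3863 * D + 1 / 4) + ε' * s ^ 3 * (1 + s)
        + μ * (s * (1 + s) * D)) / (s * (1 + s) * D) := by
    field_simp
    ring
  have e2 : c₀ + c₁ * s + c₂ * (2 * (1 - s) / (1 + s))
      = ((c₀ + c₁ * s) * (s * (1 + s) * D) + c₂ * (2 * (1 - s) * s * D)) / (s * (1 + s) * D) := by
    field_simp
  rw [e1, e2]
  gcongr

theorem pen_lt_of_le_half {μ ε ε' s c₀ c₁ c₂ : ℝ} (hμ : 0 < μ) (hμ1 : μ ≤ 1) (hε0 : 0 ≤ ε')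
    (hε : ε ≤ ε') (hs : 0 < s) (hs1 : s ≤ 1 / 2) (hc : 0 ≤ c₂)
    (h : (1 + ε' / 2) * (1 + s) < (c₀ + c₁ * s) * (1 + s) + c₂ * (2 * (1 - s))) :
    pen μ ε s < c₀ + c₁ * s - c₂ * log s := by
  have h1 := pen_le_of_le_half hμ hμ1 hε0 hε hs hs1
  have hL := mul_le_mul_of_nonneg_left (two_mul_div_le_neg_log hs (by linarith)) hc
  suffices h2 : 1 + ε' / 2 < c₀ + c₁ * s + c₂ * (2 * (1 - s) / (1 + s)) by linarith
  have e : c₀ + c₁ * s + c₂ * (2 * (1 - s) / (1 + s))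
      = ((c₀ + c₁ * s) * (1 + s) + c₂ * (2 * (1 - s))) / (1 + s) := by
    field_simp
  rwa [e, lt_div_iff₀ (by linarith)]

/-- The right side is tailored to `lower_bound_of_le_half`: `-0.9206` is just below `3 log 2 - 3`,
and one `-log s` of three is spent on the left side of the target. -/
theorem pen_tenth_lt {ε s : ℝ} (hε : ε ≤ 1 / 60) (hs : 0 < s) (hs1 : s ≤ 1) :
    pen (1 / 10) ε s < -0.9206 + 5 / 4 * s - 2 * log s := by
  rcases le_total s (1 / 2) with h | h
  · apply pen_lt_of_le_half (by norm_num) (by norm_num) (by norm_num) hε hs h (by norm_num)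
    nlinarith
  · apply pen_lt_of_polynomial (by norm_num) hε hs hs1 (by norm_num)
    nlinarith [mul_nonneg (sub_nonneg.2 h) (sub_nonneg.2 hs1), mul_nonneg (mul_nonneg (sub_nonneg.2 h) (sub_nonneg.2 hs1)) (sub_nonneg.2 hs1), mul_nonneg (mul_nonneg (sub_nonneg.2 h) (sub_nonneg.2 h)) (sub_nonneg.2 hs1), mul_nonneg (mul_nonneg (sub_nonneg.2 h) (sub_nonneg.2 hs1)) (mul_nonneg (sub_nonneg.2 h) (sub_nonneg.2 hs1)), sq_nonneg (s-0.9),sq_nonneg (s*(s-0.9))]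

/-- Tailored to `r ≥ 4`: the constant `0.196` lies below `(0.4761/2)(5/6)`, with `0.4761` and `5/6`
from `lower_bound_of_half_le`. -/
theorem pen_sixteenth_lt {ε s : ℝ} (hε : ε ≤ 1 / 256) (hs : 0 < s) (hs1 : s ≤ 1) :
    pen (1 / 16) ε s < 0.196 - 4 / 3 + 4 / 3 * s - 3 * log s := by
  rcases le_total s (1 / 2) with h | h
  · apply pen_lt_of_le_half (by norm_num) (by norm_num) (by norm_num) hε hs h (by norm_num)
    nlinarith
  · apply pen_lt_of_polynomial (by norm_num) hε hs hs1 (by norm_num)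
    nlinarith [mul_nonneg (sub_nonneg.2 h) (sub_nonneg.2 hs1), mul_nonneg (mul_nonneg (sub_nonneg.2 h) (sub_nonneg.2 hs1)) (sub_nonneg.2 hs1), mul_nonneg (mul_nonneg (sub_nonneg.2 h) (sub_nonneg.2 h)) (sub_nonneg.2 hs1), mul_nonneg (mul_nonneg (sub_nonneg.2 h) (sub_nonneg.2 hs1)) (mul_nonneg (sub_nonneg.2 h) (sub_nonneg.2 hs1)), sq_nonneg (s-0.95),sq_nonneg (s*(s-0.95))]

theorem pen_fifth_lt {ε s : ℝ} (hε : ε ≤ 3 / 64) (hs : 0 < s) (hs1 : s ≤ 1) :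
    pen (1 / 5) ε s < 0.5 + 2 / 7 * s - log s := by
  have : pen (1 / 5) ε s < 0.5 + 2 / 7 * s - 1 * log s := by
    rcases le_total s (1 / 2) with h | h
    · apply pen_lt_of_le_half (by norm_num) (by norm_num) (by norm_num) hε hs h (by norm_num)
      nlinarith
    · apply pen_lt_of_polynomial (by norm_num) hε hs hs1 (by norm_num)
      nlinarith [mul_nonneg (sub_nonneg.2 h) (sub_nonneg.2 hs1), mul_nonneg (mul_nonneg (sub_nonneg.2 h) (sub_nonneg.2 hs1)) (sub_nonneg.2 hs1), mul_nonneg (mul_nonneg (sub_nonneg.2 h) (sub_nonneg.2 h)) (sub_nonneg.2 hs1), mul_nonneg (mul_nonneg (sub_nonneg.2 h) (sub_nonneg.2 hs1)) (mul_nonneg (sub_nonneg.2 h) (sub_nonneg.2 hs1)), sq_nonneg (s-0.95),sq_nonneg (s*(s-0.95))]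
  linarith

theorem Ψ_nonneg {x t : ℝ} (hx : 0 < x) (hx1 : x < 1) (hxt : x ≤ t) : 0 ≤ Ψ x t := by
  have ht : 0 < t := by linarith
  have h := log_le_sub_one_of_pos (div_pos hx ht)
  have e : log (x / t) = -log (t / x) := by rw [← log_inv, inv_div]
  have h1 : 0 < 1 - x := by linarith
  have h2 : 0 ≤ t - x := by linarith
  have h3 : 0 ≤ (t - x) ^ 2 / (t * (1 - x)) := by positivity
  have h4 : 0 ≤ 3 / 2 * (x * (t - x) ^ 2) / (t * (3 * (1 - x) ^ 2 + x * (t - x))) := by positivity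
  unfold Ψ
  linarith

theorem log_one_add_le {ρ : ℝ} (h : 0 ≤ ρ) : 2 * log (1 + ρ) ≤ ρ * (2 + ρ) / (1 + ρ) := by
  have hm : 0 < 1 + ρ := by linarith
  have h1 := quadratic_le_mul_log (inv_pos.2 hm) (inv_le_one_of_one_le₀ (by linarith))
  rw [log_inv] at h1
  have h2 := mul_le_mul_of_nonneg_left h1 hm.le
  have e1 : (1 + ρ) * ((1 + ρ)⁻¹ * -log (1 + ρ)) = -log (1 + ρ) := by field_simp
  have e2 : (1 + ρ) * ((1 + ρ)⁻¹ - 1 + ((1 + ρ)⁻¹ - 1) ^ 2 / 2) = -(ρ * (2 + ρ) / (1 + ρ)) / 2 := by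
    field_simp; ring
  rw [e1, e2] at h2
  linarith

/-! ### The lower range `x ≤ ρ` -/

theorem Ψ_lower_eq {ρ s : ℝ} (hρ : 0 < ρ) (hρ1 : ρ < 1) (hs : 0 < s) (hs1 : s ≤ 1) :
    2 * Ψ (ρ * s) (2 * ρ / (1 + ρ)) = 2 * log 2 - 2 * log (1 + ρ) - 2 * log s
      - ((1 - ρ) + (1 - s)) / (1 + ρ) + ρ * (1 - s) ^ 2 / ((1 + ρ) * (1 - ρ * s))
      + 3 / 2 * (ρ ^ 2 * s * (2 - (1 + ρ) * s) ^ 2)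
        / (3 * (1 + ρ) * (1 - ρ * s) ^ 2 + ρ ^ 2 * s * (2 - (1 + ρ) * s)) := by
  have hy : 0 < 1 - ρ * s := by nlinarith
  have hz : 0 ≤ 2 - (1 + ρ) * s := by nlinarith
  have hm : 0 < 1 + ρ := by linarith
  have e1 : 2 * ρ / (1 + ρ) / (ρ * s) = 2 / (1 + ρ) / s := by field_simp
  have e2 : 2 * ρ / (1 + ρ) - ρ * s = ρ * (2 - (1 + ρ) * s) / (1 + ρ) := by field_simp
  have e3 : 3 * (1 - ρ * s) ^ 2 + ρ * s * (ρ * (2 - (1 + ρ) * s) / (1 + ρ))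
      = (3 * (1 + ρ) * (1 - ρ * s) ^ 2 + ρ ^ 2 * s * (2 - (1 + ρ) * s)) / (1 + ρ) := by
    field_simp
  have hW : 0 < 3 * (1 + ρ) * (1 - ρ * s) ^ 2 + ρ ^ 2 * s * (2 - (1 + ρ) * s) := by positivity
  have e4 : 3 / 2 * (ρ * s * (ρ * (2 - (1 + ρ) * s) / (1 + ρ)) ^ 2)
      / (2 * ρ / (1 + ρ) * ((3 * (1 + ρ) * (1 - ρ * s) ^ 2 + ρ ^ 2 * s * (2 - (1 + ρ) * s)) / (1 + ρ)))
      = 3 / 2 * (ρ ^ 2 * s * (2 - (1 + ρ) * s) ^ 2)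
        / (3 * (1 + ρ) * (1 - ρ * s) ^ 2 + ρ ^ 2 * s * (2 - (1 + ρ) * s)) / 2 := by
    generalize 3 * (1 + ρ) * (1 - ρ * s) ^ 2 + ρ ^ 2 * s * (2 - (1 + ρ) * s) = W at hW
    field_simp
  have e5 : 2 * (-1 + ρ * s / (2 * ρ / (1 + ρ))
        + (ρ * (2 - (1 + ρ) * s) / (1 + ρ)) ^ 2 / (2 * ρ / (1 + ρ) * (1 - ρ * s)))
      = -((1 - ρ) + (1 - s)) / (1 + ρ) + ρ * (1 - s) ^ 2 / ((1 + ρ) * (1 - ρ * s)) := by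
    field_simp
    ring
  unfold Ψ
  rw [e1, e2, e3, e4, log_div (by positivity) hs.ne', log_div two_ne_zero hm.ne']
  rw [neg_div] at e5
  linarith

theorem lower_bound_of_le_half {ρ ε s r : ℝ} (hρ : 0 < ρ) (hρ1 : ρ ≤ 1 / 2) (hr : 3 ≤ r)
    (hε : ε ≤ 1 / 60) (hs : 0 < s) (hs1 : s ≤ 1) :
    pen (1 / 10) ε s - log s < r * Ψ (ρ * s) (2 * ρ / (1 + ρ)) := by
  have hm : 0 < 1 + ρ := by linarith
  have hy : 0 < 1 - ρ * s := by nlinarith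
  have hz : 0 ≤ 2 - (1 + ρ) * s := by nlinarith
  have hΨ0 : 0 ≤ Ψ (ρ * s) (2 * ρ / (1 + ρ)) := by
    refine Ψ_nonneg (by positivity) (by linarith) ?_
    rw [le_div_iff₀ hm]
    nlinarith
  have h1 := Ψ_lower_eq hρ (by linarith) hs hs1
  have h2 := log_one_add_le hρ.le
  have h3 : 0 ≤ 3 / 2 * (ρ ^ 2 * s * (2 - (1 + ρ) * s) ^ 2)
      / (3 * (1 + ρ) * (1 - ρ * s) ^ 2 + ρ ^ 2 * s * (2 - (1 + ρ) * s)) := by positivity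
  have h4 : ρ * (1 - s) ^ 2 / (1 + ρ) ≤ ρ * (1 - s) ^ 2 / ((1 + ρ) * (1 - ρ * s)) := by
    apply div_le_div_of_nonneg_left (by positivity) (by positivity)
    nlinarith [mul_pos hρ hs]
  have h5 : ρ * (2 + ρ) / (1 + ρ) + ((1 - ρ) + (1 - s)) / (1 + ρ) - ρ * (1 - s) ^ 2 / (1 + ρ)
      ≤ 1 + (1 - s) + s / 6 := by
    rw [← add_div, ← sub_div, div_le_iff₀ hm]
    nlinarith [mul_nonneg hρ.le (sub_nonneg.2 hs1), mul_nonneg hρ.le (sub_nonneg.2 hρ1),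
      mul_nonneg hs.le (sub_nonneg.2 hρ1), mul_nonneg hρ.le (sq_nonneg (1 - s)),
      mul_nonneg (mul_nonneg hs.le (sub_nonneg.2 hs1)) hρ.le]
  have h6 := pen_tenth_lt hε hs hs1
  have h7 := log_two_gt_d9
  nlinarith

/-- The case `k = 2`, `r = 3`. Here the last term of `Ψ` cannot be discarded near `s = 1`; it is
kept as `0.1125 * s`. -/
theorem lower_bound_three_quarters {ε s : ℝ} (hε : ε ≤ 1 / 60) (hs : 0 < s) (hs1 : s ≤ 1) :
    pen (1 / 10) ε s - log s < 3 * Ψ (3 / 4 * s) (2 * (3 / 4) / (1 + 3 / 4)) := by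
  have h1 := Ψ_lower_eq (ρ := 3 / 4) (by norm_num) (by norm_num) hs hs1
  have hy : 0 < 1 - 3 / 4 * s := by linarith
  have hz : 0 ≤ 2 - (1 + 3 / 4) * s := by linarith
  have h2 : (0 : ℝ) ≤ 3 / 4 * (1 - s) ^ 2 / ((1 + 3 / 4) * (1 - 3 / 4 * s)) := by positivity
  have h3 : 0.1125 * s ≤ 3 / 2 * ((3 / 4) ^ 2 * s * (2 - (1 + 3 / 4) * s) ^ 2)
      / (3 * (1 + 3 / 4) * (1 - 3 / 4 * s) ^ 2 + (3 / 4) ^ 2 * s * (2 - (1 + 3 / 4) * s)) := by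
    rw [le_div_iff₀ (by positivity)]
    have : 0 ≤ s * (3 / 2 * ((3 / 4) ^ 2 * (2 - (1 + 3 / 4) * s) ^ 2) - 0.1125 *
      (3 * (1 + 3 / 4) * (1 - 3 / 4 * s) ^ 2 + (3 / 4) ^ 2 * s * (2 - (1 + 3 / 4) * s))) := by
      apply mul_nonneg hs.le
      nlinarith
    linarith
  have h4 := two_mul_div_le_neg_log (s := 7 / 8) (by norm_num) (by norm_num)
  rw [show (7 / 8 : ℝ) = (1 + 3 / 4) / 2 by norm_num, log_div (by norm_num) (by norm_num)] at h4
  have h6 := pen_tenth_lt hε hs hs1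
  norm_num at h1 h2 h3 h4 h6 ⊢
  linarith

/-- As `ρ → 1` the gain in `Ψ` at `s = 1` is only proportional to `1 - ρ`, hence the hypothesis on
`r * (1 - ρ)`. -/
theorem lower_bound_of_half_le {ρ ε s r : ℝ} (hρ : 1 / 2 ≤ ρ) (hρ1 : ρ < 1) (hr : 4 ≤ r)
    (hrρ : 5 / 6 ≤ r * (1 - ρ)) (hε : ε ≤ 1 / 256) (hs : 0 < s) (hs1 : s ≤ 1) :
    pen (1 / 16) ε s - log s < r * Ψ (ρ * s) (2 * ρ / (1 + ρ)) := by
  have hm : 0 < 1 + ρ := by linarith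
  have hy : 0 < 1 - ρ * s := by nlinarith
  have hz : 0 ≤ 2 - (1 + ρ) * s := by nlinarith
  have h1 := Ψ_lower_eq (by linarith) hρ1 hs hs1
  have h2 := two_mul_div_le_neg_log (s := (1 + ρ) / 2) (by linarith) (by linarith)
  rw [log_div hm.ne' two_ne_zero] at h2
  have h3 : 0 ≤ 3 / 2 * (ρ ^ 2 * s * (2 - (1 + ρ) * s) ^ 2)
      / (3 * (1 + ρ) * (1 - ρ * s) ^ 2 + ρ ^ 2 * s * (2 - (1 + ρ) * s)) := by positivity
  have h4 : 0 ≤ ρ * (1 - s) ^ 2 / ((1 + ρ) * (1 - ρ * s)) := by positivity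
  have h5 : 0.4761 * (1 - ρ) ≤ 2 * (2 * (1 - (1 + ρ) / 2) / (1 + (1 + ρ) / 2)) - (1 - ρ) / (1 + ρ) := by
    have e : 2 * (2 * (1 - (1 + ρ) / 2) / (1 + (1 + ρ) / 2)) - (1 - ρ) / (1 + ρ)
        = (1 - ρ) * (4 / (3 + ρ) - 1 / (1 + ρ)) := by
      field_simp
      ring
    rw [e, mul_comm]
    apply mul_le_mul_of_nonneg_left _ (by linarith)
    rw [div_sub_div _ _ (by positivity) (by positivity), le_div_iff₀ (by positivity)]
    nlinarith
  have h6 : (1 - s) / (1 + ρ) ≤ 2 / 3 * (1 - s) := by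
    rw [div_le_iff₀ hm]
    nlinarith
  have h7 : 2 * (1 - s) ≤ -2 * log s := by
    have := log_le_sub_one_of_pos hs
    linarith
  have h8 := pen_sixteenth_lt hε hs hs1
  rw [add_div] at h1
  have h9 : 0.4761 * (1 - ρ) + (-2 * log s - 2 / 3 * (1 - s)) ≤ 2 * Ψ (ρ * s) (2 * ρ / (1 + ρ)) := by
    linarith
  have h10 : 0 ≤ -2 * log s - 2 / 3 * (1 - s) := by linarith
  nlinarith

/-! ### The upper range `ρ ≤ x` -/

/-- In terms of `q = (1-ρ)(1-u)/(1-(1-ρ)u)` the right side is at least `(3/2) ρ (ρ+q)²/(4ρ+q)`; the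
left side is the tangent of this convex function at `q = 0`. -/
theorem rational_term_ge {ρ u : ℝ} (hρ : 0 < ρ) (hρ1 : ρ < 1) (hu : 0 < u) (hu1 : u ≤ 1) :
    3 / 8 * ρ ^ 2 + 21 / 32 * ((1 - ρ) * ρ * (1 - u) / (1 - (1 - ρ) * u))
      ≤ 3 / 2 * (1 - (1 - ρ ^ 2) * u) ^ 2
        / (3 * (1 - (1 - ρ) * u) ^ 2 + (1 - ρ) * u / (1 + ρ) * (1 - (1 - ρ ^ 2) * u)) := by
  have hσ : 0 < 1 - ρ := by linarith
  have hm : 0 < 1 + ρ := by linarith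
  have hx : 0 < 1 - (1 - ρ) * u := by nlinarith
  have hd : 0 ≤ 1 - u := by linarith
  set x := 1 - (1 - ρ) * u with hxdef
  set q := (1 - ρ) * (1 - u) / x with hq
  have hq0 : 0 ≤ q := by positivity
  have hqx : (1 - ρ) * (1 - u) = q * x := by rw [hq]; field_simp
  have hρx : ρ = x * (1 - q) := by
    have : x * (1 - q) = x - q * x := by ring
    rw [this, ← hqx, hxdef]; ring
  have hwx : 1 - (1 - ρ ^ 2) * u = x * (ρ + q) := by
    have : x * (ρ + q) = x * ρ + q * x := by ring
    rw [this, ← hqx, hxdef]; ring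
  have hθ : (1 - ρ) * u / (1 + ρ) ≤ 1 := by
    rw [div_le_one hm]; nlinarith
  have e : (1 - ρ) * ρ * (1 - u) / x = ρ * q := by rw [hq]; ring
  have hden : 3 * x ^ 2 + (1 - ρ) * u / (1 + ρ) * (x * (ρ + q)) ≤ x ^ 2 * (4 * ρ + q) / ρ := by
    rw [le_div_iff₀ hρ]
    have h1 : (1 - ρ) * u / (1 + ρ) * (x * (ρ + q)) ≤ 1 * (x * (ρ + q)) :=
      mul_le_mul_of_nonneg_right hθ (by positivity)
    have h2 : ρ ≤ x := by rw [hxdef]; nlinarith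
    have h3 : x * (ρ + q) * ρ ≤ x * (ρ + q) * x :=
      mul_le_mul_of_nonneg_left h2 (by positivity)
    have h4 := mul_le_mul_of_nonneg_right h1 hρ.le
    nlinarith
  rw [e, hwx]
  calc 3 / 8 * ρ ^ 2 + 21 / 32 * (ρ * q)
      ≤ 3 / 2 * (x * (ρ + q)) ^ 2 / (x ^ 2 * (4 * ρ + q) / ρ) := by
        rw [le_div_iff₀ (by positivity), mul_div_assoc', div_le_iff₀ hρ]
        have : 0 ≤ 27 / 32 * (x ^ 2 * ρ * q ^ 2) := by positivity
        linarith
    _ ≤ _ := by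
        apply div_le_div_of_nonneg_left (by positivity) _ hden
        have : 0 ≤ (1 - ρ) * u / (1 + ρ) := by positivity
        positivity

/-- The `ρ²` from `-log (1 - ρ²)` cancels the `-ρ²` of the quadratic part, so for small `ρ` and `u =
1` the leading term is `3/8 ρ²` from the last fraction of `Ψ`. -/
theorem Ψ_upper_ge {ρ u : ℝ} (hρ : 0 < ρ) (hρ1 : ρ < 1) (hu : 0 < u) (hu1 : u ≤ 1) :
    -log u - (1 - ρ) * ρ * (1 - u) / ((1 + ρ) * (1 - (1 - ρ) * u)) + ρ ^ 3 / (1 + ρ) + ρ ^ 4 / 2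
      + (1 - ρ) * u / (1 + ρ) * (3 / 8 * ρ ^ 2
        + 21 / 32 * ((1 - ρ) * ρ * (1 - u) / (1 - (1 - ρ) * u)))
    ≤ Ψ ((1 - ρ) * u) (1 / (1 + ρ)) := by
  have hσ : 0 < 1 - ρ := by linarith
  have hm : 0 < 1 + ρ := by linarith
  have hx : 0 < 1 - (1 - ρ) * u := by nlinarith
  have hd : 0 ≤ 1 - u := by linarith
  have hρ2 : 0 < 1 - ρ ^ 2 := by nlinarith
  have hw : 0 ≤ 1 - (1 - ρ ^ 2) * u := by nlinarith
  -- the logarithm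
  have l1 : log (1 / (1 + ρ) / ((1 - ρ) * u)) = -log (1 - ρ ^ 2) - log u := by
    rw [show 1 / (1 + ρ) / ((1 - ρ) * u) = ((1 - ρ ^ 2) * u)⁻¹ by field_simp; ring, log_inv,
      log_mul hρ2.ne' hu.ne']
    ring
  have l2 : ρ ^ 2 + ρ ^ 4 / 2 ≤ -log (1 - ρ ^ 2) := by
    refine le_trans ?_ (two_mul_div_le_neg_log hρ2 (by nlinarith))
    rw [le_div_iff₀ (by linarith)]
    nlinarith [pow_pos hρ 6]
  -- the quadratic term
  have q1 : -1 + (1 - ρ) * u / (1 / (1 + ρ))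
      + (1 / (1 + ρ) - (1 - ρ) * u) ^ 2 / (1 / (1 + ρ) * (1 - (1 - ρ) * u))
      = -ρ ^ 2 + ρ ^ 3 / (1 + ρ) - (1 - ρ) * ρ * (1 - u) / ((1 + ρ) * (1 - (1 - ρ) * u)) := by
    field_simp
    ring
  -- the last term
  have a1 : 3 / 2 * ((1 - ρ) * u * (1 / (1 + ρ) - (1 - ρ) * u) ^ 2)
      / (1 / (1 + ρ) * (3 * (1 - (1 - ρ) * u) ^ 2 + (1 - ρ) * u * (1 / (1 + ρ) - (1 - ρ) * u)))
      = (1 - ρ) * u / (1 + ρ) * (3 / 2 * (1 - (1 - ρ ^ 2) * u) ^ 2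
        / (3 * (1 - (1 - ρ) * u) ^ 2 + (1 - ρ) * u / (1 + ρ) * (1 - (1 - ρ ^ 2) * u))) := by
    have e1 : 1 / (1 + ρ) - (1 - ρ) * u = (1 - (1 - ρ ^ 2) * u) / (1 + ρ) := by
      field_simp; ring
    have e2 : (1 - ρ) * u * ((1 - (1 - ρ ^ 2) * u) / (1 + ρ))
        = (1 - ρ) * u / (1 + ρ) * (1 - (1 - ρ ^ 2) * u) := by ring
    have hW : 0 < 3 * (1 - (1 - ρ) * u) ^ 2
        + (1 - ρ) * u / (1 + ρ) * (1 - (1 - ρ ^ 2) * u) := by positivity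
    rw [e1, e2]
    generalize 3 * (1 - (1 - ρ) * u) ^ 2
        + (1 - ρ) * u / (1 + ρ) * (1 - (1 - ρ ^ 2) * u) = W at hW
    field_simp
  have a3 := mul_le_mul_of_nonneg_left (rational_term_ge hρ hρ1 hu hu1) (show 0 ≤ (1 - ρ) * u / (1 + ρ) by positivity)
  unfold Ψ
  rw [l1, a1]
  linarith

theorem Ψ_upper_ge_simple {ρ u : ℝ} (hρ : 0 < ρ) (hρ1 : ρ < 1) (hu : 0 < u) (hu1 : u ≤ 1) :
    -log u - (1 - ρ) / (1 + ρ) * (1 - u) + ρ ^ 3 / (1 + ρ) + ρ ^ 4 / 2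
    ≤ Ψ ((1 - ρ) * u) (1 / (1 + ρ)) := by
  have h := Ψ_upper_ge hρ hρ1 hu hu1
  have hσ : 0 < 1 - ρ := by linarith
  have hm : 0 < 1 + ρ := by linarith
  have hx : 0 < 1 - (1 - ρ) * u := by nlinarith
  have hd : 0 ≤ 1 - u := by linarith
  have h1 : (1 - ρ) * ρ * (1 - u) / ((1 + ρ) * (1 - (1 - ρ) * u)) ≤ (1 - ρ) / (1 + ρ) * (1 - u) := by
    rw [div_mul_eq_mul_div, div_le_div_iff₀ (by positivity) hm]
    have : 0 ≤ (1 - ρ) * (1 - u) * (1 + ρ) * (1 - (1 - ρ) * u - ρ) := by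
      apply mul_nonneg (by positivity)
      nlinarith
    nlinarith
  have h2 : 0 ≤ (1 - ρ) * u / (1 + ρ) * (3 / 8 * ρ ^ 2
        + 21 / 32 * ((1 - ρ) * ρ * (1 - u) / (1 - (1 - ρ) * u))) := by positivity
  linarith

theorem upper_bound_of_half_le {ρ ε u κ : ℝ} (hρ : 1 / 2 ≤ ρ) (hρ1 : ρ < 1) (hκ : 3 ≤ κ)
    (hε : ε ≤ 1 / 60) (hu : 0 < u) (hu1 : u ≤ 1) :
    pen (1 / 10) ε u - log u < κ * Ψ ((1 - ρ) * u) (1 / (1 + ρ)) := by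
  have hm : 0 < 1 + ρ := by linarith
  have hρ0 : 0 < ρ := by linarith
  have h := Ψ_upper_ge_simple hρ0 hρ1 hu hu1
  have hl : log u ≤ 0 := log_nonpos hu.le hu1
  have h1 : (1 - ρ) / (1 + ρ) * (1 - u) ≤ 1 / 3 * (1 - u) := by
    apply mul_le_mul_of_nonneg_right _ (by linarith)
    rw [div_le_iff₀ hm]; linarith
  have h2 : (1 : ℝ) / 12 ≤ ρ ^ 3 / (1 + ρ) := by
    rw [le_div_iff₀ hm]
    nlinarith [pow_le_pow_left₀ (by norm_num) hρ 2, pow_le_pow_left₀ (by norm_num) hρ 3]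
  have h3 : (1 : ℝ) / 16 ≤ ρ ^ 4 := by
    have := pow_le_pow_left₀ (by norm_num) hρ 4
    norm_num at this ⊢
    linarith
  have h4 := pen_tenth_lt hε hu hu1
  have hl' : 1 - u ≤ -log u := by
    have := log_le_sub_one_of_pos hu
    linarith
  have hΨ : 0 ≤ Ψ ((1 - ρ) * u) (1 / (1 + ρ)) := by linarith
  have h5 := mul_le_mul_of_nonneg_right hκ hΨ
  linarith

theorem upper_bound_three_quarters {ε u : ℝ} (hε : ε ≤ 3 / 64) (hu : 0 < u) (hu1 : u ≤ 1) :
    pen (1 / 5) ε u - log u < 2 * Ψ ((1 - 3 / 4) * u) (1 / (1 + 3 / 4)) := by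
  have h := Ψ_upper_ge_simple (ρ := 3 / 4) (by norm_num) (by norm_num) hu hu1
  have h4 := pen_fifth_lt hε hu hu1
  norm_num at h h4 ⊢
  linarith

theorem small_deficit_polynomial_pos {p d : ℝ} (hp : 0 < p) (hp1 : p ≤ 1 / 2) (hd : 0 ≤ d)
    (hd1 : d ≤ 1 / 10) :
    0 < (1 + p) * (d + d ^ 2 / 2) - (1 - p) * d * (1 - 21 / 32 * (1 - p) * (1 - d)) + p ^ 3
      + (1 + p) * p ^ 4 / 2 + 3 / 8 * p ^ 2 * (1 - p) * (1 - d)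
      - (1 + p) * (d * (0.25 + 1.3864 * p) + d ^ 2 * (0.2858 + 2.456 * p) + p ^ 2 * 0.3264) := by
  have h0 : 0 < p ^ 3 + (1 + p) * p ^ 4 / 2 + 3 / 8 * p ^ 2 * (1 - p)
      - (1 + p) * (p ^ 2 * 0.3264) := by
    have : 0 < p ^ 2 * (p + (1 + p) * p ^ 2 / 2 + 3 / 8 * (1 - p) - (1 + p) * 0.3264) := by
      apply mul_pos (by positivity)
      nlinarith [mul_pos hp hp, mul_pos (mul_pos hp hp) hp]
    linarith
  have h1 : 0 < (1 + p) * (1 / 10 + 1 / 200)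
      - (1 - p) * (1 / 10) * (1 - 21 / 32 * (1 - p) * (9 / 10)) + p ^ 3 + (1 + p) * p ^ 4 / 2
      + 3 / 8 * p ^ 2 * (1 - p) * (9 / 10) - (1 + p) * ((1 / 10) * (0.25 + 1.3864 * p)
        + 1 / 100 * (0.2858 + 2.456 * p) + p ^ 2 * 0.3264) := by
    nlinarith [sq_nonneg (p - 0.295), mul_nonneg hp.le (sq_nonneg (p - 0.295)),
      mul_nonneg (sq_nonneg p) (sq_nonneg (p - 0.295)), mul_nonneg hp.le (sub_nonneg.2 hp1),
      pow_pos hp 3, pow_pos hp 5]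
  -- The coefficient of `d²`: the expression is concave in `d`, so the endpoints `0` and `1/10`
  -- (`h0`, `h1`) suffice.
  have h2 : (1 + p) * (0.2142 - 2.456 * p) - 21 / 32 * (1 - p) ^ 2 ≤ 0 := by nlinarith
  nlinarith [mul_nonneg (mul_nonneg hd (sub_nonneg.2 hd1)) (neg_nonneg.2 h2),
    mul_nonneg hd h1.le, mul_nonneg (sub_nonneg.2 hd1) h0.le]

/-- Expanded in `e`, the cubic has nonnegative coefficients and a positive constant term. -/
theorem large_deficit_polynomial_pos {p e : ℝ} (hp : 0 < p) (hp1 : p ≤ 1 / 2) (he : 0 ≤ e) :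
    0 < (1 - 2 * p) * ((e + 1 / 10) + (e + 1 / 10) ^ 2 / 2)
        * ((1 + p) * (p + (1 - p) * (e + 1 / 10)))
      - (1 - p) * p * (e + 1 / 10) * (1 - 21 / 32 * (1 - p) * (1 - (e + 1 / 10)))
      + (p + (1 - p) * (e + 1 / 10)) * (p ^ 3 + (1 + p) * p ^ 4 / 2
        + 3 / 8 * p ^ 2 * (1 - p) * (1 - (e + 1 / 10)))
      - (2 * p / 3) * (0.3294 - 5 / 4 * (e + 1 / 10))
        * ((1 + p) * (p + (1 - p) * (e + 1 / 10))) := by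
  have hq : 0 ≤ 1 / 2 - p := by linarith
  have h0 : 0 < 21 / 2000 + 35323 / 1200000 * p - 28337 / 120000 * p ^ 2
      + 46969 / 400000 * p ^ 3 + 517 / 800 * p ^ 4 + 1 / 2 * p ^ 5 + 9 / 20 * p ^ 6 := by
    nlinarith [sq_nonneg (p - 0.27), mul_nonneg hp.le (sq_nonneg (p - 0.27)),
      mul_nonneg (sq_nonneg p) (sq_nonneg (p - 0.27)), mul_nonneg hp.le hq,
      pow_pos hp 3, pow_pos hp 5, pow_pos hp 6]
  have h1 : 0 ≤ 43 / 200 + 2131 / 15000 * p - 139 / 600 * p ^ 2 - 2503 / 7500 * p ^ 3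
      + 7 / 40 * p ^ 4 - 1 / 2 * p ^ 6 := by
    nlinarith [mul_nonneg hp.le hq, pow_pos hp 3, mul_nonneg (pow_pos hp 2).le hq,
      mul_nonneg (pow_pos hp 3).le hq, mul_nonneg (pow_pos hp 4).le hq,
      mul_nonneg (pow_pos hp 5).le hq]
  have h2 : 0 ≤ 23 / 20 - 779 / 480 * p - 57 / 80 * p ^ 2 + 269 / 480 * p ^ 3
      - 3 / 8 * p ^ 4 := by
    nlinarith [mul_nonneg hp.le hq, pow_pos hp 3, mul_nonneg (pow_pos hp 2).le hq,
      mul_nonneg (pow_pos hp 3).le hq]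
  have h3 : 0 ≤ 1 / 2 - p - 1 / 2 * p ^ 2 + p ^ 3 := by
    have : 0 ≤ (1 / 2 - p) * (1 - p ^ 2) := mul_nonneg hq (by nlinarith)
    linarith
  linarith [mul_nonneg h1 he, mul_nonneg h2 (pow_nonneg he 2), mul_nonneg h3 (pow_nonneg he 3)]

theorem upper_bound_large_deficit {ρ ε u κ : ℝ} (hρ : 0 < ρ) (hρ1 : ρ ≤ 1 / 2)
    (hκ : 3 ≤ 2 * ρ * κ) (hε : ε ≤ 1 / 60) (hu : 0 < u) (hu1 : u ≤ 9 / 10) :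
    pen (1 / 10) ε u - log u < κ * Ψ ((1 - ρ) * u) (1 / (1 + ρ)) := by
  have hm : 0 < 1 + ρ := by linarith
  have hσ : 0 < 1 - ρ := by linarith
  have hx : 0 < 1 - (1 - ρ) * u := by nlinarith
  have hd : 0 ≤ 1 - u := by linarith
  have h := Ψ_upper_ge hρ (by linarith) hu (by linarith)
  have h4 := pen_tenth_lt hε hu (by linarith)
  have hL : (1 - u) + (1 - u) ^ 2 / 2 ≤ -log u := by
    refine le_trans ?_ (two_mul_div_le_neg_log hu (by linarith))
    rw [le_div_iff₀ (by linarith)]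
    nlinarith [pow_nonneg hd 3]
  -- The share `2ρ` of `-log u` is reserved for the `-3 log u` on the other side, which is scaled by
  -- `2ρ/3`.
  have h5 := mul_le_mul_of_nonneg_left hL (show 0 ≤ 1 - 2 * ρ by linarith)
  have hP := large_deficit_polynomial_pos hρ hρ1 (e := 9 / 10 - u) (by linarith)
  rw [show 9 / 10 - u + 1 / 10 = 1 - u by ring,
    show ρ + (1 - ρ) * (1 - u) = 1 - (1 - ρ) * u by ring,
    show 1 - (1 - u) = u by ring] at hP
  have key : 2 * ρ / 3 * (0.3294 - 5 / 4 * (1 - u)) <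
      (1 - 2 * ρ) * ((1 - u) + (1 - u) ^ 2 / 2)
      - (1 - ρ) * ρ * (1 - u) / ((1 + ρ) * (1 - (1 - ρ) * u)) + ρ ^ 3 / (1 + ρ) + ρ ^ 4 / 2
      + (1 - ρ) * u / (1 + ρ) * (3 / 8 * ρ ^ 2
        + 21 / 32 * ((1 - ρ) * ρ * (1 - u) / (1 - (1 - ρ) * u))) := by
    generalize 1 - (1 - ρ) * u = x at hP hx
    rw [← sub_pos]
    refine lt_of_lt_of_eq (div_pos hP (mul_pos hm hx)) ?_
    field_simp
    ring
  have hΨ : 2 * ρ / 3 * (0.3294 - 5 / 4 * (1 - u) - 3 * log u)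
      < Ψ ((1 - ρ) * u) (1 / (1 + ρ)) := by linarith
  have hpos : 0 ≤ Ψ ((1 - ρ) * u) (1 / (1 + ρ)) := by
    apply Ψ_nonneg (by positivity) (by linarith)
    rw [le_div_iff₀ hm]
    nlinarith
  have hκ0 : 0 < κ := by
    by_contra hcon
    have := mul_nonneg hρ.le (neg_nonneg.2 (not_lt.1 hcon))
    linarith
  have h6 : 3 / (2 * ρ) * Ψ ((1 - ρ) * u) (1 / (1 + ρ))
      ≤ κ * Ψ ((1 - ρ) * u) (1 / (1 + ρ)) := by
    apply mul_le_mul_of_nonneg_right _ hpos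
    rw [div_le_iff₀ (by linarith)]
    linarith
  have h7 := mul_lt_mul_of_pos_left hΨ (show 0 < 3 / (2 * ρ) by positivity)
  have h8 : 3 / (2 * ρ) * (2 * ρ / 3 * (0.3294 - 5 / 4 * (1 - u) - 3 * log u))
      = 0.3294 - 5 / 4 * (1 - u) - 3 * log u := by
    field_simp
  linarith

/-- At `u = 1` the penalty is `μ + ε/μ`; with `ε = O(ρ²)`, taking `μ = ρ/3` makes it `O(ρ)`, the
order of `κ Ψ` when `κ` is about `3/(2ρ)`. The bound on `-log (ρ/3)` is tangent at `ρ = 3/8`. -/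
theorem pen_third_le {ρ ε u : ℝ} (hρ : 0 < ρ) (hε : ε ≤ 5 / 96 * ρ ^ 2) (hu : 9 / 10 ≤ u)
    (hu1 : u ≤ 1) :
    2 * ρ / 3 * (pen (ρ / 3) ε u - log u)
      ≤ (1 - u) * (0.25 + 1.3864 * ρ) + (1 - u) ^ 2 * (0.2858 + 2.456 * ρ) + ρ ^ 2 * 0.3264 := by
  have hu0 : 0 < u := by linarith
  have hd : 0 ≤ 1 - u := by linarith
  set y := (1 - u) / u with hy
  have hy0 : 0 ≤ y := by positivity
  have hyu : -log u ≤ y := by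
    have := one_sub_inv_le_log_of_pos hu0
    have e : y = u⁻¹ - 1 := by rw [hy]; field_simp
    linarith
  have hy1 : y ≤ (1 - u) + 8 / 7 * (1 - u) ^ 2 := by
    rw [hy, div_le_iff₀ hu0]
    nlinarith [mul_nonneg hd hd]
  have hy2 : y ^ 2 ≤ 64 / 49 * (1 - u) ^ 2 := by
    have : y ≤ 8 / 7 * (1 - u) := by
      rw [hy, div_le_iff₀ hu0]
      nlinarith
    calc y ^ 2 ≤ (8 / 7 * (1 - u)) ^ 2 := pow_le_pow_left₀ hy0 this 2
      _ = _ := by ring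
  have hD : ρ / 3 * u ≤ 1 - u + ρ / 3 * u := by linarith
  have hD0 : 0 < ρ / 3 * u := by positivity
  have hlogD : -log (1 - u + ρ / 3 * u) ≤ 1.0795 + 3 / (8 * ρ) + y := by
    have h1 := log_le_log hD0 hD
    have h2 := log_le_sub_one_of_pos (show 0 < 3 / (8 * ρ) by positivity)
    rw [log_div (by norm_num) (by positivity), log_mul (by norm_num) hρ.ne',
      show (8 : ℝ) = 2 ^ 3 by norm_num, log_pow] at h2
    rw [log_mul (by positivity) hu0.ne', log_div hρ.ne' (by norm_num)] at h1
    have h3 := log_two_lt_d9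
    push_cast at h2
    norm_num at h2 ⊢
    linarith
  have hpen : pen (ρ / 3) ε u ≤ ρ / 3 + y * (1.0795 + 3 / (8 * ρ) + y) + 5 / 32 * ρ := by
    unfold pen
    have h1 := mul_le_mul_of_nonneg_left hlogD hy0
    have h2 : ε * u ^ 2 / (1 - u + ρ / 3 * u) ≤ 5 / 32 * ρ := by
      rw [div_le_iff₀ (by linarith)]
      calc ε * u ^ 2 ≤ 5 / 96 * ρ ^ 2 * u ^ 2 := mul_le_mul_of_nonneg_right hε (by positivity)
        _ ≤ 5 / 96 * ρ ^ 2 * u := by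
            apply mul_le_mul_of_nonneg_left _ (by positivity)
            nlinarith
        _ = 5 / 32 * ρ * (ρ / 3 * u) := by ring
        _ ≤ _ := mul_le_mul_of_nonneg_left hD (by positivity)
    linarith
  have hrhs : 2 * ρ / 3 * (ρ / 3 + y * (1.0795 + 3 / (8 * ρ) + y) + 5 / 32 * ρ + y)
      ≤ (1 - u) * (0.25 + 1.3864 * ρ) + (1 - u) ^ 2 * (0.2858 + 2.456 * ρ) + ρ ^ 2 * 0.3264 := by
    have e : 2 * ρ / 3 * (ρ / 3 + y * (1.0795 + 3 / (8 * ρ) + y) + 5 / 32 * ρ + y)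
        = ρ ^ 2 * (2 / 9 + 5 / 48) + y * (1 / 4 + 2 / 3 * 2.0795 * ρ) + 2 / 3 * ρ * y ^ 2 := by
      field_simp
      ring
    rw [e]
    have h1 := mul_le_mul_of_nonneg_right hy1 (show 0 ≤ 1 / 4 + 2 / 3 * 2.0795 * ρ by positivity)
    have h2 := mul_le_mul_of_nonneg_left hy2 (show 0 ≤ 2 / 3 * ρ by positivity)
    have h3 : 0 ≤ (1 - u) ^ 2 * ρ := by positivity
    have h4 : 0 ≤ (1 - u) * ρ := by positivity
    linarith [sq_nonneg (1 - u), sq_nonneg ρ]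
  refine le_trans (mul_le_mul_of_nonneg_left ?_ (by positivity)) hrhs
  linarith

theorem upper_bound_small_deficit {ρ ε u κ : ℝ} (hρ : 0 < ρ) (hρ1 : ρ ≤ 1 / 2)
    (hκ : 3 ≤ 2 * ρ * κ) (hε : ε ≤ 5 / 96 * ρ ^ 2) (hu : 9 / 10 ≤ u) (hu1 : u ≤ 1) :
    pen (ρ / 3) ε u - log u < κ * Ψ ((1 - ρ) * u) (1 / (1 + ρ)) := by
  have hm : 0 < 1 + ρ := by linarith
  have hσ : 0 < 1 - ρ := by linarith
  have hu0 : 0 < u := by linarith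
  have hx : 0 < 1 - (1 - ρ) * u := by nlinarith
  have hd : 0 ≤ 1 - u := by linarith
  have h := Ψ_upper_ge hρ (by linarith) hu0 hu1
  have hL : (1 - u) + (1 - u) ^ 2 / 2 ≤ -log u := by
    refine le_trans ?_ (two_mul_div_le_neg_log hu0 hu1)
    rw [le_div_iff₀ (by linarith)]
    nlinarith [pow_nonneg hd 3]
  have hP := small_deficit_polynomial_pos hρ hρ1 hd (by linarith)
  rw [show 1 - (1 - u) = u by ring] at hP
  have hq : (1 - ρ) * ρ * (1 - u) / (1 - (1 - ρ) * u) ≤ (1 - ρ) * (1 - u) := by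
    rw [div_le_iff₀ hx]
    have : 0 ≤ (1 - ρ) * (1 - u) * (1 - (1 - ρ) * u - ρ) := by
      apply mul_nonneg (by positivity)
      nlinarith
    linarith
  have hpre : (1 - ρ) * (1 - u) * (1 - 21 / 32 * (1 - ρ) * u) / (1 + ρ)
      ≥ (1 - ρ) * ρ * (1 - u) / ((1 + ρ) * (1 - (1 - ρ) * u))
        - (1 - ρ) * u / (1 + ρ) * (21 / 32 * ((1 - ρ) * ρ * (1 - u) / (1 - (1 - ρ) * u))) := by
    have e : (1 - ρ) * ρ * (1 - u) / ((1 + ρ) * (1 - (1 - ρ) * u))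
        - (1 - ρ) * u / (1 + ρ) * (21 / 32 * ((1 - ρ) * ρ * (1 - u) / (1 - (1 - ρ) * u)))
        = (1 - ρ) * ρ * (1 - u) / (1 - (1 - ρ) * u) * (1 - 21 / 32 * (1 - ρ) * u) / (1 + ρ) := by
      generalize 1 - (1 - ρ) * u = x at hx
      field_simp
    rw [e, ge_iff_le]
    apply div_le_div_of_nonneg_right _ hm.le
    apply mul_le_mul_of_nonneg_right hq
    nlinarith
  have key : (1 - u) * (0.25 + 1.3864 * ρ) + (1 - u) ^ 2 * (0.2858 + 2.456 * ρ) + ρ ^ 2 * 0.3264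
      < (1 - u) + (1 - u) ^ 2 / 2 - (1 - ρ) * (1 - u) * (1 - 21 / 32 * (1 - ρ) * u) / (1 + ρ)
        + ρ ^ 3 / (1 + ρ) + ρ ^ 4 / 2 + (1 - ρ) * u / (1 + ρ) * (3 / 8 * ρ ^ 2) := by
    rw [← sub_pos]
    refine lt_of_lt_of_eq (div_pos hP hm) ?_
    field_simp
  have hΨ : 2 * ρ / 3 * (pen (ρ / 3) ε u - log u) < Ψ ((1 - ρ) * u) (1 / (1 + ρ)) := by
    have hrhs := pen_third_le hρ hε hu hu1
    rw [mul_add] at h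
    linarith
  have hpos : 0 ≤ Ψ ((1 - ρ) * u) (1 / (1 + ρ)) := by
    apply Ψ_nonneg (by positivity) (by linarith)
    rw [le_div_iff₀ hm]
    nlinarith
  have h6 : 3 / (2 * ρ) * Ψ ((1 - ρ) * u) (1 / (1 + ρ))
      ≤ κ * Ψ ((1 - ρ) * u) (1 / (1 + ρ)) := by
    apply mul_le_mul_of_nonneg_right _ hpos
    rw [div_le_iff₀ (by linarith)]
    linarith
  have h7 := mul_lt_mul_of_pos_left hΨ (show 0 < 3 / (2 * ρ) by positivity)
  have h8 : 3 / (2 * ρ) * (2 * ρ / 3 * (pen (ρ / 3) ε u - log u)) = pen (ρ / 3) ε u - log u := by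
    field_simp
  linarith

/-! ### Size of the parameter `ε` -/

theorem mul_le_two_pow {n : ℕ} (hn : 9 ≤ n) : 40 * n ≤ 2 ^ n := by
  induction n, hn using Nat.le_induction with
  | base => norm_num
  | succ n hn ih => rw [pow_succ]; omega

theorem mul_le_five_mul_two_pow {n : ℕ} (hn : 5 ≤ n) : 32 * n ≤ 5 * 2 ^ n := by
  induction n, hn using Nat.le_induction with
  | base => norm_num
  | succ n hn ih => rw [pow_succ]; omega

theorem tail_le_sixtieth {k : ℕ} {ρ : ℝ} (hk : 3 ≤ k) (hρ1 : ρ < 1)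
    (hρk : 3 ≤ 2 * (k : ℝ) * ρ) : (1 - ρ) / ρ * ((1 - ρ) / 2) ^ k ≤ 1 / 60 := by
  have hk0 : (3 : ℝ) ≤ k := by exact_mod_cast hk
  have hρ : 0 < ρ := by
    by_contra h
    nlinarith
  have hσ : 0 ≤ 1 - ρ := by linarith
  set c : ℝ := 1 - 3 / (2 * k) with hc
  have hσc : 1 - ρ ≤ c := by
    have : 3 / (2 * (k : ℝ)) ≤ ρ := by
      rw [div_le_iff₀ (by linarith)]; linarith
    linarith
  have hinv : 1 / ρ ≤ 2 * k / 3 := by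
    rw [div_le_div_iff₀ hρ (by norm_num)]; linarith
  have h1 : (1 - ρ) / ρ * ((1 - ρ) / 2) ^ k ≤ c * (2 * k / 3) * (c / 2) ^ k := by
    rw [div_eq_mul_one_div (1 - ρ) ρ]
    have hc0 : 0 ≤ c := hσ.trans hσc
    gcongr
  refine h1.trans ?_
  rcases le_or_gt 9 k with h9 | h9
  · have hc0 : 0 ≤ c := hσ.trans hσc
    have hc1 : c ≤ 1 := by
      have : 0 ≤ 3 / (2 * (k : ℝ)) := by positivity
      linarith
    have h2 : (c / 2) ^ k ≤ (1 / 2) ^ k := by gcongr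
    have h3 : (40 : ℝ) * k ≤ 2 ^ k := by exact_mod_cast mul_le_two_pow h9
    calc c * (2 * k / 3) * (c / 2) ^ k ≤ 1 * (2 * k / 3) * (1 / 2) ^ k := by gcongr
      _ = 2 * k / 3 / 2 ^ k := by rw [one_div_pow]; ring
      _ ≤ 1 / 60 := by
          rw [div_le_div_iff₀ (by positivity) (by norm_num)]
          linarith
  · rw [hc]
    interval_cases k <;> norm_num

theorem tail_le_square {k r : ℕ} {ρ : ℝ} (hr : 3 ≤ r) (hrk : r < k)
    (hρ : (r : ℝ) = 2 * k * ρ) : ρ / (1 - ρ) * ((1 - ρ) / 2) ^ k ≤ 5 / 96 * ρ ^ 2 := by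
  have hk0 : (0 : ℝ) < k := by exact_mod_cast (by omega : 0 < k)
  have hr3 : (3 : ℝ) ≤ r := by exact_mod_cast hr
  have hrk' : (r : ℝ) < k := by exact_mod_cast hrk
  have hρ0 : 0 < ρ := by
    by_contra h
    nlinarith
  have hρ1 : ρ < 1 / 2 := by
    by_contra h
    nlinarith
  have hσ : 0 < 1 - ρ := by linarith
  rcases Nat.lt_or_ge k 5 with h5 | h5
  · obtain rfl : k = 4 := by omega
    obtain rfl : r = 3 := by omega
    have : ρ = 3 / 8 := by push_cast at hρ; linarith
    rw [this]; norm_num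
  · obtain ⟨n, rfl⟩ : ∃ n, k = n + 1 := ⟨k - 1, by omega⟩
    have hn : (4 : ℝ) ≤ n := by exact_mod_cast (by omega : 4 ≤ n)
    push_cast at hρ hk0 hrk'
    have hnρ : 1 ≤ n * ρ := by nlinarith
    -- Bernoulli for `(1+ρ)^n` together with `(1-ρ)(1+ρ) ≤ 1`.
    have h1 : (1 - ρ) ^ n ≤ 1 / 2 := by
      have h2 : 1 + n * ρ ≤ (1 + ρ) ^ n := one_add_mul_le_pow (by linarith) n
      have h3 : (1 - ρ) ^ n * (1 + ρ) ^ n ≤ 1 := by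
        rw [← mul_pow]
        exact pow_le_one₀ (by nlinarith) (by nlinarith)
      have h4 : 0 < (1 - ρ) ^ n := by positivity
      nlinarith
    have h2 : (32 : ℝ) * (n + 1 : ℕ) ≤ 5 * 2 ^ (n + 1) := by
      exact_mod_cast mul_le_five_mul_two_pow h5
    push_cast at h2
    have e : ρ / (1 - ρ) * ((1 - ρ) / 2) ^ (n + 1) = ρ * (1 - ρ) ^ n / 2 ^ (n + 1) := by
      rw [div_pow, pow_succ (1 - ρ)]
      field_simp
    rw [e, div_le_iff₀ (by positivity)]
    have h3 : (1 : ℝ) / 2 ≤ 5 / 96 * ρ * 2 ^ (n + 1) := by nlinarith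
    calc ρ * (1 - ρ) ^ n ≤ ρ * (1 / 2) := by gcongr
      _ ≤ ρ * (5 / 96 * ρ * 2 ^ (n + 1)) := by gcongr
      _ = _ := by ring

/-! ### Choice of `μ` in all cases -/

theorem exists_pen_lt_lower {k r : ℕ} {ρ : ℝ} (hk : 2 ≤ k) (hr : 3 ≤ r) (hrk : r < 2 * k)
    (hρ : (r : ℝ) = 2 * k * ρ) : ∃ μ > 0, ∀ s : ℝ, 0 < s → s ≤ 1 →
      pen μ ((1 - ρ) / ρ * ((1 - ρ) / 2) ^ k) s - log s < r * Ψ (ρ * s) (2 * ρ / (1 + ρ)) := by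
  have hk0 : (0 : ℝ) < k := by exact_mod_cast (by omega : 0 < k)
  have hr3 : (3 : ℝ) ≤ r := by exact_mod_cast hr
  have hrk' : (r : ℝ) + 1 ≤ 2 * k := by exact_mod_cast hrk
  have hρ0 : 0 < ρ := by
    by_contra h
    nlinarith
  have hρ1 : ρ < 1 := by
    by_contra h
    nlinarith
  rcases le_or_gt r k with h | h
  · have h' : (r : ℝ) ≤ k := by exact_mod_cast h
    have hε := tail_le_sixtieth (k := k) (by omega) hρ1 (by linarith)
    exact ⟨1 / 10, by norm_num, fun s hs hs1 =>
      lower_bound_of_le_half hρ0 (by nlinarith) hr3 hε hs hs1⟩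
  · rcases hk.eq_or_lt with rfl | h3
    · obtain rfl : r = 3 := by omega
      obtain rfl : ρ = 3 / 4 := by push_cast at hρ; linarith
      refine ⟨1 / 10, by norm_num, fun s hs hs1 => ?_⟩
      have := lower_bound_three_quarters
        (ε := (1 - 3 / 4) / (3 / 4) * ((1 - 3 / 4) / 2) ^ 2) (by norm_num) hs hs1
      push_cast
      exact this
    · have h' : (k : ℝ) + 1 ≤ r := by exact_mod_cast h
      have h3' : (3 : ℝ) ≤ k := by exact_mod_cast h3
      have hρ2 : 1 / 2 ≤ ρ := by nlinarith
      have hσ : 0 < 1 - ρ := by linarith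
      have hε : (1 - ρ) / ρ * ((1 - ρ) / 2) ^ k ≤ 1 / 256 := by
        rcases Nat.lt_or_ge k 4 with h4 | h4
        · obtain rfl : k = 3 := by omega
          push_cast at hρ h'
          have h5 : 1 - ρ ≤ 1 / 3 := by linarith
          have h6 : (1 - ρ) / ρ ≤ 1 / 2 := by
            rw [div_le_iff₀ hρ0]; linarith
          calc (1 - ρ) / ρ * ((1 - ρ) / 2) ^ 3 ≤ 1 / 2 * (1 / 3 / 2) ^ 3 := by gcongr
            _ ≤ 1 / 256 := by norm_num
        · have h6 : (1 - ρ) / ρ ≤ 1 := by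
            rw [div_le_iff₀ hρ0]; linarith
          have h7 : ((1 - ρ) / 2) ^ k ≤ ((1 - ρ) / 2) ^ 4 :=
            pow_le_pow_of_le_one (by linarith) (by linarith) h4
          have h8 : (1 - ρ) / 2 ≤ 1 / 4 := by linarith
          calc (1 - ρ) / ρ * ((1 - ρ) / 2) ^ k ≤ 1 * (1 / 4) ^ 4 := by
                refine mul_le_mul h6 (h7.trans ?_) (by positivity) zero_le_one
                gcongr
            _ ≤ 1 / 256 := by norm_num
      refine ⟨1 / 16, by norm_num, fun s hs hs1 =>
        lower_bound_of_half_le hρ2 hρ1 (by linarith) ?_ hε hs hs1⟩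
      -- This says `r(2k-r) ≥ 2k-1`, so `r(1-ρ) ≥ 1 - 1/(2k) ≥ 5/6` for `k ≥ 3`.
      have h5 : 0 ≤ ((r : ℝ) - 1) * (2 * k - r - 1) := mul_nonneg (by linarith) (by linarith)
      have h6 : (r : ℝ) * (2 * k - r) = 2 * k * (r * (1 - ρ)) := by rw [hρ]; ring
      by_contra hcon
      rw [not_le] at hcon
      have h7 := mul_lt_mul_of_pos_left hcon (show (0 : ℝ) < 2 * k by linarith)
      nlinarith

theorem exists_pen_lt_upper {k r : ℕ} {ρ : ℝ} (hk : 2 ≤ k) (hr : 3 ≤ r) (hrk : r < 2 * k)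
    (hρ : (r : ℝ) = 2 * k * ρ) {u : ℝ} (hu : 0 < u) (hu1 : u ≤ 1) : ∃ μ > 0,
      pen μ (ρ / (1 - ρ) * ((1 - ρ) / 2) ^ k) u - log u
        < k * Ψ ((1 - ρ) * u) (1 / (1 + ρ)) := by
  have hk0 : (0 : ℝ) < k := by exact_mod_cast (by omega : 0 < k)
  have hr3 : (3 : ℝ) ≤ r := by exact_mod_cast hr
  have hrk' : (r : ℝ) + 1 ≤ 2 * k := by exact_mod_cast hrk
  have hρ0 : 0 < ρ := by
    by_contra h
    nlinarith
  have hρ1 : ρ < 1 := by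
    by_contra h
    nlinarith
  have hσ : 0 < 1 - ρ := by linarith
  rcases le_or_gt k r with h | h
  · rcases hk.eq_or_lt with rfl | h3
    · obtain rfl : r = 3 := by omega
      obtain rfl : ρ = 3 / 4 := by push_cast at hρ; linarith
      refine ⟨1 / 5, by norm_num, ?_⟩
      have := upper_bound_three_quarters
        (ε := 3 / 4 / (1 - 3 / 4) * ((1 - 3 / 4) / 2) ^ 2) (by norm_num) hu hu1
      push_cast
      exact this
    · have h' : (k : ℝ) ≤ r := by exact_mod_cast h
      have hρ2 : 1 / 2 ≤ ρ := by nlinarith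
      refine ⟨1 / 10, by norm_num,
        upper_bound_of_half_le hρ2 hρ1 (by exact_mod_cast h3) ?_ hu hu1⟩
      have h7 : ((1 - ρ) / 2) ^ k ≤ ((1 - ρ) / 2) ^ 3 :=
        pow_le_pow_of_le_one (by linarith) (by linarith) h3
      calc ρ / (1 - ρ) * ((1 - ρ) / 2) ^ k ≤ ρ / (1 - ρ) * ((1 - ρ) / 2) ^ 3 := by gcongr
        _ = ρ * (1 - ρ) * (1 - ρ) / 8 := by field_simp; ring
        _ ≤ 1 / 60 := by nlinarith [sq_nonneg (ρ - 1 / 2), mul_pos hρ0 hσ]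
  · have h' : (r : ℝ) ≤ k := by exact_mod_cast h.le
    have hρ2 : ρ ≤ 1 / 2 := by nlinarith
    have hε := tail_le_square hr h hρ
    have hκ : 3 ≤ 2 * ρ * k := by linarith
    rcases le_total u (9 / 10) with hu9 | hu9
    · refine ⟨1 / 10, by norm_num, upper_bound_large_deficit hρ0 hρ2 hκ (hε.trans ?_) hu hu9⟩
      nlinarith
    · exact ⟨ρ / 3, by positivity, upper_bound_small_deficit hρ0 hρ2 hκ hε hu9 hu1⟩

/-! ### First-moment exponent and assembly -/

/-- Near `0` the first moment exponent is negative. -/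
theorem Fd_neg {d t κ : ℝ} (ht : 0 < t) (ht1 : t < 1) (hκ : 2 ≤ κ) (hd : d * t = 2 * κ) :
    Fd d (t ^ 2 * exp (-4)) t < 0 := by
  have he : exp (-4) < 1 / 4 := by
    have h := add_one_lt_exp (show (4 : ℝ) ≠ 0 by norm_num)
    rw [exp_neg, ← one_div]
    exact one_div_lt_one_div_of_lt (by norm_num) (by linarith)
  have he0 := exp_pos (-4)
  have hlx : log (t ^ 2 * exp (-4)) = 2 * log t - 4 := by
    rw [log_mul (by positivity) he0.ne', log_pow, log_exp]
    push_cast; ring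
  have hxt : t ^ 2 * exp (-4) < t / 4 := by nlinarith
  have hx : 0 < t ^ 2 * exp (-4) := by positivity
  generalize t ^ 2 * exp (-4) = x at *
  have hd0 : 0 < d := by
    by_contra h
    nlinarith
  have h1 := mul_le_mul_of_nonneg_left
    (F_le_neg_Ψ hx (by linarith) (by linarith) ht1 (by nlinarith)) hd0.le
  have hΨ : log t - log x - 1 ≤ Ψ x t := by
    unfold Ψ
    rw [log_div ht.ne' hx.ne']
    have h3 : 0 < 1 - x := by linarith
    have h4 : 0 ≤ t - x := by linarith
    have h5 : 0 ≤ (t - x) ^ 2 / (t * (1 - x)) := by positivity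
    have h6 : 0 ≤ 3 / 2 * (x * (t - x) ^ 2) / (t * (3 * (1 - x) ^ 2 + x * (t - x))) := by
      positivity
    have h7 : 0 ≤ x / t := by positivity
    linarith
  have h2 := negMulLog_le_tangent (a := 1 - x) (q := 1) (by linarith) one_pos
  rw [log_one] at h2
  have e1 : d * -(t * x / 2 * Ψ x t) = -(κ * x * Ψ x t) := by
    rw [show d * -(t * x / 2 * Ψ x t) = -(d * t * (x * Ψ x t) / 2) by ring, hd]
    ring
  have e2 : negMulLog x = -(x * log x) := by simp [negMulLog]
  have hlt : log t < 0 := log_neg ht ht1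
  -- At `x = t² e⁻⁴` the left side is `5 - 2 log t`, while `κ Ψ ≥ 2 (3 - log t)`.
  have h3 : 1 - log x < κ * Ψ x t := by
    rw [hlx] at hΨ ⊢
    have h8 : 2 * (log t - (2 * log t - 4) - 1) ≤ κ * (log t - (2 * log t - 4) - 1) :=
      mul_le_mul_of_nonneg_right hκ (by linarith)
    have h9 := mul_le_mul_of_nonneg_left hΨ (show 0 ≤ κ by linarith)
    linarith
  have h4 := mul_lt_mul_of_pos_left h3 hx
  unfold Fd
  rw [e2]
  rw [e1] at h1
  nlinarith

theorem η_neg_of_exponent {d x t α κ ε : ℝ} {T : ℝ} (hd : d * t = 2 * κ) (hd0 : 0 ≤ d)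
    (hx : 0 < x) (hx1 : x < 1) (hxt : x ≤ t) (ht : t < 1) (hC : 0 < 1 - (2 - t) * x) {μ : ℝ}
    (hT : T ≤ d * F x t + x * (pen μ ε (x / α) - log (x / α)))
    (h : pen μ ε (x / α) - log (x / α) < κ * Ψ x t) : T < 0 := by
  have h1 := mul_le_mul_of_nonneg_left (F_le_neg_Ψ hx hx1 hxt ht hC) hd0
  have e1 : d * -(t * x / 2 * Ψ x t) = -(x * (κ * Ψ x t)) := by
    rw [show d * -(t * x / 2 * Ψ x t) = -(d * t * (x * Ψ x t) / 2) by ring, hd]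
    ring
  rw [e1] at h1
  have h2 := mul_lt_mul_of_pos_left h hx
  linarith

theorem η_neg {k r : ℕ} (hk : 2 ≤ k) (hr : 3 ≤ r) (hrk : r < 2 * k) {x₁ x₂ : ℝ}
    (h₁ : x₁ ∈ Set.Icc 0 (α₁ k r)) (h₂ : x₂ ∈ Set.Icc 0 (α₂ k r)) (hx : 0 < x₁ + x₂)
    (hx1 : x₁ + x₂ < 1) (hratio : x₁ * α₂ k r ≤ α₁ k r * x₂) : η k r x₁ x₂ < 0 := by
  have hk0 : (0 : ℝ) < k := by exact_mod_cast (by omega : 0 < k)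
  have hr3 : (3 : ℝ) ≤ r := by exact_mod_cast hr
  have hrk' : (r : ℝ) + 1 ≤ 2 * k := by exact_mod_cast hrk
  have hα₁ : α₁ k r = 1 - α₂ k r := rfl
  have hρ : (r : ℝ) = 2 * k * α₂ k r := by unfold α₂; field_simp
  unfold η
  rw [hα₁] at h₁ hratio ⊢
  clear hα₁
  have hdeg : deg k r = 2 * k * (1 + α₂ k r) := by
    unfold deg
    rw [mul_add, ← hρ]; ring
  generalize α₂ k r = ρ at *
  have hρ0 : 0 < ρ := by
    by_contra h
    nlinarith
  have hρ1 : ρ < 1 := by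
    by_contra h
    nlinarith
  have hm : 0 < 1 + ρ := by linarith
  have hσ : 0 < 1 - ρ := by linarith
  have hd0 : 0 ≤ deg k r := by rw [hdeg]; positivity
  have hT : 2 * (r : ℝ) / deg k r + 2 * (k : ℝ) * x₁ / (deg k r * (x₁ + x₂))
      = (2 * ρ + x₁ / (x₁ + x₂)) / (1 + ρ) := by
    rw [hdeg, hρ]; field_simp
  rw [hT]
  obtain ⟨h10, h11⟩ := h₁
  obtain ⟨h20, h21⟩ := h₂
  rcases le_total (x₁ + x₂) ρ with hle | hge
  · obtain ⟨μ, hμ, hpen⟩ := exists_pen_lt_lower hk hr hrk hρ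
    have hC : 0 < 1 - (2 - 2 * ρ / (1 + ρ)) * (x₁ + x₂) := by
      have e : 1 - (2 - 2 * ρ / (1 + ρ)) * (x₁ + x₂) = (1 + ρ - 2 * (x₁ + x₂)) / (1 + ρ) := by
        field_simp; ring
      rw [e]
      exact div_pos (by linarith) hm
    have hs : (x₁ + x₂) / ρ ≤ 1 := (div_le_one hρ0).2 hle
    have hp := hpen ((x₁ + x₂) / ρ) (by positivity) hs
    rw [mul_div_cancel₀ _ hρ0.ne'] at hp
    have ht1 : 2 * ρ / (1 + ρ) < 1 := (div_lt_one hm).2 (by linarith)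
    have hxt : x₁ + x₂ ≤ 2 * ρ / (1 + ρ) := by
      rw [le_div_iff₀ hm]; nlinarith
    have hE := exponent_le (k := k) (d := deg k r) (x := x₁ + x₂) (t := 2 * ρ / (1 + ρ)) (α := ρ)
      (β := 1 - ρ) (ξ := x₂) (ζ := x₁) (Δ := x₁ / (1 + ρ)) (μ := μ) (c := (1 - ρ) / 2)
      hk hρ0 hσ h20 h21 h10 h11 (add_comm _ _) hx hle (by positivity) ht1 hC (by positivity)
      (by
        -- The ratio hypothesis is exactly nonnegativity of the mixed edge class.
        have e : (1 - 2 * ρ / (1 + ρ)) * (x₁ + x₂) - x₁ / (1 + ρ)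
            = ((1 - ρ) * x₂ - x₁ * ρ) / (1 + ρ) := by field_simp; ring
        rw [e]
        exact div_nonneg (by linarith) hm.le)
      hd0 (by rw [hdeg]; field_simp) hμ (by positivity)
      (by
        have e : 2 * ρ / (1 + ρ) * (1 - (2 - 2 * ρ / (1 + ρ)) * (x₁ + x₂))
            / ((1 - 2 * ρ / (1 + ρ)) ^ 2 * (x₁ + x₂))
            = 2 * ρ * (1 + ρ - 2 * (x₁ + x₂)) / ((1 - ρ) ^ 2 * (x₁ + x₂)) := by
          have e1 : 1 - 2 * ρ / (1 + ρ) = (1 - ρ) / (1 + ρ) := by field_simp; ring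
          rw [e1]; field_simp; ring
        have e' : 1 / ((1 - ρ) / 2 * ((x₁ + x₂) / ρ)) = 2 * ρ * (1 - ρ) / ((1 - ρ) ^ 2 * (x₁ + x₂)) := by
          field_simp
        rw [e, e']
        exact div_le_div_of_nonneg_right
          (mul_le_mul_of_nonneg_left (by linarith) (by positivity)) (by positivity))
    refine η_neg_of_exponent (d := deg k r) (κ := r) (by rw [hdeg, hρ]; field_simp) hd0 hx hx1 hxt
      ht1 hC (le_trans (le_of_eq ?_) hE) hp
    unfold F
    have a1 : (2 * ρ + x₁ / (x₁ + x₂)) / (1 + ρ) * (x₁ + x₂)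
        = 2 * ρ / (1 + ρ) * (x₁ + x₂) + x₁ / (1 + ρ) := by field_simp
    have a2 : (1 - (2 * ρ + x₁ / (x₁ + x₂)) / (1 + ρ)) * (x₁ + x₂)
        = (1 - 2 * ρ / (1 + ρ)) * (x₁ + x₂) - x₁ / (1 + ρ) := by
      rw [sub_mul, a1]; ring
    have a3 : 1 - (2 - (2 * ρ + x₁ / (x₁ + x₂)) / (1 + ρ)) * (x₁ + x₂)
        = 1 - (2 - 2 * ρ / (1 + ρ)) * (x₁ + x₂) + x₁ / (1 + ρ) := by
      rw [sub_mul, a1]; ring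
    rw [a1, a2, a3]
    ring
  · have hy : 0 < 1 - (x₁ + x₂) := by linarith
    have hys : 1 - (x₁ + x₂) ≤ 1 - ρ := by linarith
    have hs : (1 - (x₁ + x₂)) / (1 - ρ) ≤ 1 := (div_le_one hσ).2 hys
    obtain ⟨μ, hμ, hp⟩ := exists_pen_lt_upper hk hr hrk hρ (u := (1 - (x₁ + x₂)) / (1 - ρ))
      (by positivity) hs
    rw [mul_div_cancel₀ _ hσ.ne'] at hp
    have hC' : 2 * ρ ^ 2 ≤ 1 + ρ - (1 + 2 * ρ) * (1 - (x₁ + x₂)) := by nlinarith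
    have hC : 0 < 1 - (2 - 1 / (1 + ρ)) * (1 - (x₁ + x₂)) := by
      have e : 1 - (2 - 1 / (1 + ρ)) * (1 - (x₁ + x₂))
          = (1 + ρ - (1 + 2 * ρ) * (1 - (x₁ + x₂))) / (1 + ρ) := by
        field_simp; ring
      rw [e]
      exact div_pos (lt_of_lt_of_le (by positivity) hC') hm
    have ht1 : 1 / (1 + ρ) < 1 := (div_lt_one hm).2 (by linarith)
    have hyt : 1 - (x₁ + x₂) ≤ 1 / (1 + ρ) := by
      rw [le_div_iff₀ hm]; nlinarith
    have hE := exponent_le (k := k) (d := deg k r) (x := 1 - (x₁ + x₂)) (t := 1 / (1 + ρ))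
      (α := 1 - ρ) (β := ρ) (ξ := 1 - ρ - x₁) (ζ := ρ - x₂) (Δ := (ρ - x₂) / (1 + ρ)) (μ := μ)
      (c := (1 - ρ) / 2) hk hσ hρ0 (by linarith) (by linarith) (by linarith) (by linarith)
      (by ring) hy hys (by positivity) ht1 hC (div_nonneg (by linarith) hm.le)
      (by
        have e : (1 - 1 / (1 + ρ)) * (1 - (x₁ + x₂)) - (ρ - x₂) / (1 + ρ)
            = ((1 - ρ) * x₂ - x₁ * ρ) / (1 + ρ) := by field_simp; ring
        rw [e]
        exact div_nonneg (by linarith) hm.le)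
      hd0 (by rw [hdeg]; field_simp) hμ (by positivity)
      (by
        generalize 1 - (x₁ + x₂) = y at *
        have e : 1 / (1 + ρ) * (1 - (2 - 1 / (1 + ρ)) * y) / ((1 - 1 / (1 + ρ)) ^ 2 * y)
            = (1 + ρ - (1 + 2 * ρ) * y) / (ρ ^ 2 * y) := by
          have e1 : 1 - 1 / (1 + ρ) = ρ / (1 + ρ) := by field_simp; ring
          rw [e1]; field_simp; ring
        have e' : 1 / ((1 - ρ) / 2 * (y / (1 - ρ))) = 2 * ρ ^ 2 / (ρ ^ 2 * y) := by
          field_simp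
        rw [e, e']
        gcongr)
    refine η_neg_of_exponent (d := deg k r) (κ := k) (by rw [hdeg]; field_simp) hd0 hy
      (by linarith) hyt ht1 hC (le_trans (le_of_eq ?_) hE) hp
    unfold F g
    -- Complementation: the class inside the set for `x` is the class outside it for `1 - x`, and
    -- the mixed class is unchanged.
    have b1 : (2 * ρ + x₁ / (x₁ + x₂)) / (1 + ρ) * (x₁ + x₂)
        = 1 - (2 - 1 / (1 + ρ)) * (1 - (x₁ + x₂)) + (ρ - x₂) / (1 + ρ) := by field_simp; ring
    have b2 : (1 - (2 * ρ + x₁ / (x₁ + x₂)) / (1 + ρ)) * (x₁ + x₂)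
        = (1 - 1 / (1 + ρ)) * (1 - (x₁ + x₂)) - (ρ - x₂) / (1 + ρ) := by
      rw [sub_mul, b1]; ring
    have b3 : 1 - (2 - (2 * ρ + x₁ / (x₁ + x₂)) / (1 + ρ)) * (x₁ + x₂)
        = 1 / (1 + ρ) * (1 - (x₁ + x₂)) + (ρ - x₂) / (1 + ρ) := by
      rw [sub_mul, b1]; ring
    rw [b1, b2, b3, sub_sub_cancel, sub_sub_cancel, sub_sub_cancel]
    ring

end StarProfile

/-- The ratio condition `x₁/x₂ ≤ α₁/α₂` is written in its cross-multiplied form. -/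
theorem lemma4p2 (k r : ℕ) (hk : 2 ≤ k) (hr : 3 ≤ r) (hrk : r < 2 * k) :
    ∃ xm xp : ℝ, 0 < xm ∧ xm < xp ∧ xp < 1 ∧
      xm < 2 * (r : ℝ) / StarProfile.deg k r ∧
      1 - xp < 2 * (k : ℝ) / StarProfile.deg k r ∧
      StarProfile.Fd (StarProfile.deg k r) xm (2 * (r : ℝ) / StarProfile.deg k r) < 0 ∧
      StarProfile.Fd (StarProfile.deg k r) (1 - xp) (2 * (k : ℝ) / StarProfile.deg k r) < 0 ∧
      ∀ x₁ x₂ : ℝ, x₁ ∈ Set.Icc 0 (StarProfile.α₁ k r) → x₂ ∈ Set.Icc 0 (StarProfile.α₂ k r) →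
        x₁ + x₂ ∈ Set.Icc xm xp →
        x₁ * StarProfile.α₂ k r ≤ StarProfile.α₁ k r * x₂ →
        StarProfile.η k r x₁ x₂ < 0 := by
  have hk2 : (2 : ℝ) ≤ k := by exact_mod_cast hk
  have hr3 : (3 : ℝ) ≤ r := by exact_mod_cast hr
  have hrk' : (r : ℝ) < 2 * k := by exact_mod_cast hrk
  have hd : 0 < StarProfile.deg k r := by unfold StarProfile.deg; linarith
  have ht : 0 < 2 * (r : ℝ) / StarProfile.deg k r := by positivity
  have ht1 : 2 * (r : ℝ) / StarProfile.deg k r < 1 := by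
    rw [div_lt_one hd]; unfold StarProfile.deg; linarith
  have hu : 0 < 2 * (k : ℝ) / StarProfile.deg k r := by positivity
  have hu1 : 2 * (k : ℝ) / StarProfile.deg k r < 1 := by
    rw [div_lt_one hd]; unfold StarProfile.deg; linarith
  have hFt := StarProfile.Fd_neg (d := StarProfile.deg k r) (κ := r) ht ht1 (by linarith)
    (by field_simp)
  have hFu := StarProfile.Fd_neg (d := StarProfile.deg k r) (κ := k) hu hu1 hk2 (by field_simp)
  have he : Real.exp (-4) < 1 / 4 := by
    have h := Real.add_one_lt_exp (show (4 : ℝ) ≠ 0 by norm_num)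
    rw [Real.exp_neg, ← one_div]
    exact one_div_lt_one_div_of_lt (by norm_num) (by linarith)
  have he0 := Real.exp_pos (-4)
  have hsmall : ∀ t : ℝ, 0 < t → t < 1 → 0 < t ^ 2 * Real.exp (-4) ∧
      t ^ 2 * Real.exp (-4) < t / 4 := fun t h0 h1 => ⟨by positivity, by nlinarith⟩
  obtain ⟨hm0, hm1⟩ := hsmall _ ht ht1
  obtain ⟨hp0, hp1⟩ := hsmall _ hu hu1
  refine ⟨_, 1 - (2 * (k : ℝ) / StarProfile.deg k r) ^ 2 * Real.exp (-4), hm0, by linarith,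
    by linarith, by linarith, by linarith, hFt, ?_, ?_⟩
  · rwa [sub_sub_cancel]
  · intro x₁ x₂ h₁ h₂ hx hratio
    exact StarProfile.η_neg hk hr hrk h₁ h₂ (lt_of_lt_of_le hm0 hx.1)
      (lt_of_le_of_lt hx.2 (by linarith)) hratio
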